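/- Let $d\mu(z)=\pi^{-1}e^{-|z|^2}dv(z)$ be the Gaussian measure on $\mathbb{C}$, let $F^2(\mathbb{C})$ be the Segal--Bargmann space of entire functions in $L^2(\mathbb{C},d\mu)$, and let $K_a(w)=e^{w\bar a}$. For $\varphi:\mathbb{C}\to\mathbb{C}$ let $$T_\varphi f(z)=\int_{\mathbb C}\varphi(w)e^{z\bar w}f(w)\,d\mu(w),\qquad \mathrm{Dom}(T_\varphi)=\{f\in F^2(\mathbb{C}):\varphi f\in L^2(\mathbb{C},d\mu)\};$$ $T_\varphi$ is called a Toeplitz operator if $K_a\in\mathrm{Dom}(T_\varphi)$ for all $a\in\mathbb{C}$, and $\mathrm{Dom}(T_\varphi T_\psi)=\{f\in \mathrm{Dom}(T_\psi): T_\psi f\in\mathrm{Dom}(T_\varphi)\}$. A function $a$ on $\mathbb{R}_+$ is identified with the radial symbol $a(|z|)$. For $p\in\{1,2\}$, let $L_p^\infty(\mathbb{R}_+,e^{-r^2})$ be the space of measurable $a$ on $\mathbb{R}_+$ with $\int_0^\infty|a(r)|^p e^{-r^2}r^{n+p-1}\,dr<\infty$ for all integers $n\ge0$. Put $$\gamma_a(n)=\frac1{n!}\int_0^\infty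 a(\sqrt r)\,r^ne^{-r}dr,\qquad q_a(n)=\int_0^\infty|a(r)|^2e^{-r^2}r^{n+1}dr .$$ Let $B_a(\mathbb{C})$ be the smooth Bochner algebra, i.e. the set of Fourier--Stieltjes transforms $z\mapsto\int e^{i\,\mathrm{Re}(z\bar a)}d\nu(a)$ of compactly supported complex Borel measures $\nu$ on $\mathbb{C}$. **Proposition.** Let $\varphi,\psi\in B_a(\mathbb{C})$ be radial. Then $\varphi$ and $\psi$ are smooth, the series $$\varphi\diamond\psi=\sum_{k=0}^\infty\frac{(-1)^k}{k!}(\partial^k\varphi)(\bar\partial^k\psi),\qquad \partial=\tfrac{\partial}{\partial z},\ \bar\partial=\tfrac{\partial}{\partial\bar z},$$ converges absolutely at every point of $\mathbb{C}$, and: 1. $T_\varphi$ and $T_\psi$ are Toeplitz operators; $\varphi,\psi\in L_1^\infty(\mathbb{R}_+,e^{-r^2})$; $T_\psi$ is bounded; the sequence $\{\gamma_\varphi(n)\gamma_\psi(n)\}_n$ is bounded; $\varphi\in L_2^\infty(\mathbb{R}_+,e^{-r^2})$; and $\sum_{n\ge0}x^nq_\varphi(n)/n!$ converges for all $x\ge0$.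 2. There exists $\tau\in L_1^\infty(\mathbb{R}_+,e^{-r^2})$ such that $T_\tau$ is a Toeplitz operator and $T_\tau=T_\varphi T_\psi$ (equal domains and equal values), and every such $\tau$ satisfies $\tau(|z|)=(\varphi\diamond\psi)(z)$ for almost every $z\in\mathbb{C}$. -/

import Mathlib

open MeasureTheory Set
open scoped NNReal ENNReal ComplexConjugate ContDiff

noncomputable section

namespace SegalBargmann

/-- The Gaussian measure `dμ(z) = π⁻¹ e^{-|z|²} dv(z)` on `ℂ`. -/
def gaussian : Measure ℂ :=
  (volume : Measure ℂ).withDensity (fun z => ENNReal.ofReal (Real.pi⁻¹ * Real.exp (-‖z‖ ^ 2)))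

/-- The Segal-Bargmann space `F²(ℂ)`: the entire functions that are square integrable with
respect to the Gaussian measure. -/
def fock : Set (ℂ → ℂ) := {f | Differentiable ℂ f ∧ MemLp f 2 gaussian}

/-- The coherent state `K_a(w) = e^{w ā}`. -/
def coherent (a : ℂ) : ℂ → ℂ := fun w => Complex.exp (w * conj a)

/-- The domain `{f ∈ F² : φ f ∈ L²(μ)}` of the operator `T_φ`. -/
def toeplitzDom (φ : ℂ → ℂ) : Set (ℂ → ℂ) :=
  {f | f ∈ fock ∧ MemLp (fun w => φ w * f w) 2 gaussian}

/-- `T_φ f (z) = ∫ φ(w) e^{z w̄} f(w) dμ(w) = P[φ f](z)`. -/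
def toeplitz (φ f : ℂ → ℂ) : ℂ → ℂ :=
  fun z => ∫ w, φ w * Complex.exp (z * conj w) * f w ∂gaussian

/-- `T_φ` is a Toeplitz (anti Wick) operator: all coherent states lie in its domain. -/
def IsToeplitz (φ : ℂ → ℂ) : Prop := ∀ a : ℂ, coherent a ∈ toeplitzDom φ

/-- `T_φ` is bounded on its domain for the norm of `L²(μ)`. -/
def IsBoundedToeplitz (φ : ℂ → ℂ) : Prop :=
  ∃ C : ℝ≥0, ∀ f ∈ toeplitzDom φ,
    eLpNorm (toeplitz φ f) 2 gaussian ≤ C * eLpNorm f 2 gaussian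

/-- The domain of the composition `T_φ T_ψ`. -/
def compDom (φ ψ : ℂ → ℂ) : Set (ℂ → ℂ) :=
  {f | f ∈ toeplitzDom ψ ∧ toeplitz ψ f ∈ toeplitzDom φ}

/-- The radial function `z ↦ a(|z|)` on `ℂ` with profile `a`. -/
def radial (a : ℝ → ℂ) : ℂ → ℂ := fun z => a ‖z‖

/-- The space `L₁^∞(ℝ₊, e^{-r²})`. -/
def MemL1Infty (a : ℝ → ℂ) : Prop :=
  AEStronglyMeasurable a (volume.restrict (Ioi 0)) ∧
    ∀ n : ℕ, IntegrableOn (fun r => ‖a r‖ * Real.exp (-r ^ 2) * r ^ n) (Ioi 0)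

/-- The space `L₂^∞(ℝ₊, e^{-r²})`. -/
def MemL2Infty (a : ℝ → ℂ) : Prop :=
  AEStronglyMeasurable a (volume.restrict (Ioi 0)) ∧
    ∀ n : ℕ, IntegrableOn (fun r => ‖a r‖ ^ 2 * Real.exp (-r ^ 2) * r ^ (n + 1)) (Ioi 0)

/-- `q_a(n) = ∫_{ℝ₊} |a(r)|² e^{-r²} r^{n+1} dr`. -/
def q (a : ℝ → ℂ) (n : ℕ) : ℝ :=
  ∫ r in Ioi (0 : ℝ), ‖a r‖ ^ 2 * Real.exp (-r ^ 2) * r ^ (n + 1)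

/-- `γ_a(n) = (1/n!) ∫_{ℝ₊} a(√r) rⁿ e^{-r} dr`. -/
def gam (a : ℝ → ℂ) (n : ℕ) : ℂ :=
  (1 / (n.factorial : ℂ)) *
    ∫ r in Ioi (0 : ℝ), a (Real.sqrt r) * ((r ^ n * Real.exp (-r) : ℝ) : ℂ)

/-- The hypotheses of the composition theorem for Toeplitz operators with radial symbols
`φ(|z|)` and `ψ(|z|)`. -/
structure CompositionHypotheses (φ ψ : ℝ → ℂ) : Prop where
  toeplitz_left : IsToeplitz (radial φ)
  toeplitz_right : IsToeplitz (radial ψ)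
  memL1_left : MemL1Infty φ
  memL1_right : MemL1Infty ψ
  bounded_right : IsBoundedToeplitz (radial ψ)
  bounded_gam : ∃ C : ℝ, ∀ n : ℕ, ‖gam φ n * gam ψ n‖ ≤ C
  memL2_left : MemL2Infty φ
  summable_left : ∀ x : ℝ, 0 ≤ x → Summable (fun n : ℕ => x ^ n * q φ n / (n.factorial : ℝ))

/-- The conclusion of the composition theorem about `τ`: it belongs to `L₁^∞(ℝ₊, e^{-r²})`,
`T_τ` is a Toeplitz operator, and `T_τ = T_φ T_ψ` (same domain and same values). -/
structure IsCompositionSymbol (φ ψ τ : ℝ → ℂ) : Prop where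
  memL1 : MemL1Infty τ
  toeplitz : IsToeplitz (radial τ)
  dom_eq : toeplitzDom (radial τ) = compDom (radial φ) (radial ψ)
  eq_comp : ∀ f ∈ compDom (radial φ) (radial ψ),
    SegalBargmann.toeplitz (radial τ) f =
      SegalBargmann.toeplitz (radial φ) (SegalBargmann.toeplitz (radial ψ) f)

/-- The smooth Bochner algebra `B_a(ℂ)`: the Fourier-Stieltjes transforms
`z ↦ ∫ e^{i Re(z ā)} dν(a)` of the complex Borel measures `ν` with compact support in `ℂ`. -/
def smoothBochner : Set (ℂ → ℂ) :=
  {φ | ∃ (ν : ComplexMeasure ℂ) (K : Set ℂ), IsCompact K ∧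
    (∀ S : Set ℂ, MeasurableSet S → Disjoint S K → ν S = 0) ∧
    ∀ z : ℂ, φ z = ν.integral
      (fun a => Complex.exp (Complex.I * (((z * conj a).re : ℝ) : ℂ)))
      (ContinuousLinearMap.mul ℝ ℂ)}

/-- The Wirtinger derivative `∂f = ½ (∂f/∂x - i ∂f/∂y)`. -/
def dz (f : ℂ → ℂ) : ℂ → ℂ :=
  fun z => (1 / 2 : ℂ) * (fderiv ℝ f z 1 - Complex.I * fderiv ℝ f z Complex.I)

/-- The Wirtinger derivative `∂̄f = ½ (∂f/∂x + i ∂f/∂y)`. -/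
def dzbar (f : ℂ → ℂ) : ℂ → ℂ :=
  fun z => (1 / 2 : ℂ) * (fderiv ℝ f z 1 + Complex.I * fderiv ℝ f z Complex.I)

/-- The `k`-th term `((-1)^k / k!) (∂^k φ)(∂̄^k ψ)` of `φ ⋄ ψ`. -/
def diamondTerm (φ ψ : ℂ → ℂ) (k : ℕ) : ℂ → ℂ :=
  fun z => (-1 : ℂ) ^ k / (k.factorial : ℂ) * (dz^[k] φ z * dzbar^[k] ψ z)

/-- `φ ⋄ ψ = ∑_k ((-1)^k / k!) (∂^k φ)(∂̄^k ψ)`. -/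
def diamond (φ ψ : ℂ → ℂ) : ℂ → ℂ := fun z => ∑' k : ℕ, diamondTerm φ ψ k z

end SegalBargmann

end

/-! A symbol in the smooth Bochner algebra is a superposition of characters `e^{i Re(z ā)}`.
Completing exponents in the reproducing formula shows that each character acts as a weighted shift,
`f ↦ e^{i z ā/2 - |a|²/4} f(z + i a/2)`. Two such shifts compose to `e^{ā b/4}` times the shift
attached to `a + b`. Integrating over both measures, `T_φ T_ψ` has the symbol `∬ e^{ā b/4} e^{i Re(z
conj(a+b))}`, which is `compositionSymbol`; this is `toeplitz_compositionSymbol`.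

On characters `∂` multiplies by `i ā/2` and `∂̄` by `i b/2`, so the `k`-th term of `φ ⋄ ψ` is the
contribution of `(ā b/4)^k / k!` to that symbol. Compact support bounds `ā b`, hence the exponential
series may be summed under the integral (`hasSum_diamondTerm`). The sum is radial because rotation
factors cancel in every term (`diamondTerm_mul_of_norm_eq_one`).

All symbols involved are bounded. A Schur test makes their operators bounded on `F²`, so every
domain is all of `F²`, and the remaining growth conditions are elementary. Uniqueness holds because
matrix entries on coherent states already give the Fourier transform of the symbol times the
Gaussian (`ae_eq_of_toeplitz_coherent_eq`). -/

namespace SegalBargmann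

/-! ### Complex measures as unimodular densities against their variation. -/

section ComplexMeasure

variable {X : Type*} [MeasurableSpace X]

lemma isFiniteMeasure_variation (ν : ComplexMeasure X) : IsFiniteMeasure ν.variation := by
  have hle : ν.variation ≤ (ComplexMeasure.re ν).totalVariation +
      (ComplexMeasure.im ν).totalVariation := by
    refine VectorMeasure.variation_le_of_forall_enorm_le fun E _ => ?_
    have h1 := SignedMeasure.enorm_le_totalVariation (ComplexMeasure.re ν) E
    have h2 := SignedMeasure.enorm_le_totalVariation (ComplexMeasure.im ν) E
    have h3 : ‖ν E‖ₑ ≤ ‖(ν E).re‖ₑ + ‖(ν E).im‖ₑ := by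
      rw [← ofReal_norm, ← ofReal_norm, ← ofReal_norm,
        ← ENNReal.ofReal_add (norm_nonneg _) (norm_nonneg _)]
      exact ENNReal.ofReal_le_ofReal (Complex.norm_le_abs_re_add_abs_im _)
    exact h3.trans (add_le_add h1 h2)
  have : IsFiniteMeasure (ComplexMeasure.re ν).totalVariation := by
    unfold SignedMeasure.totalVariation; infer_instance
  have : IsFiniteMeasure (ComplexMeasure.im ν).totalVariation := by
    unfold SignedMeasure.totalVariation; infer_instance
  exact isFiniteMeasure_of_le _ hle

/-- Absolute continuity passes to the real and imaginary parts, where the Radon-Nikodym theorem for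
signed measures applies. -/
lemma withDensity_rnDeriv_variation (ν : ComplexMeasure X) :
    ν.variation.withDensityᵥ (ν.rnDeriv ν.variation) = ν := by
  have := isFiniteMeasure_variation ν
  have hac : ν ≪ᵥ ν.variation.toENNRealVectorMeasure := ν.absolutelyContinuous
  obtain ⟨hre, him⟩ := (ComplexMeasure.absolutelyContinuous_ennreal_iff _ _).1 hac
  have h1 := SignedMeasure.withDensityᵥ_rnDeriv_eq _ _ hre
  have h2 := SignedMeasure.withDensityᵥ_rnDeriv_eq _ _ him
  have hint := ν.integrable_rnDeriv ν.variation
  ext i hi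
  rw [withDensityᵥ_apply hint hi]
  apply Complex.ext
  · rw [← RCLike.re_eq_complex_re, ← integral_re hint.integrableOn]
    have := congrArg (fun s => s i) h1
    simp only [withDensityᵥ_apply (SignedMeasure.integrable_rnDeriv _ _) hi] at this
    exact this
  · rw [← RCLike.im_eq_complex_im, ← integral_im hint.integrableOn]
    have := congrArg (fun s => s i) h2
    simp only [withDensityᵥ_apply (SignedMeasure.integrable_rnDeriv _ _) hi] at this
    exact this

/-- The variation of a measure with density `h` has density `|h|`. Here it is also the base measure
itself, with density `1`, and densities are unique almost everywhere. -/
lemma norm_rnDeriv_variation (ν : ComplexMeasure X) :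
    ∀ᵐ x ∂ν.variation, ‖ν.rnDeriv ν.variation x‖ = 1 := by
  have := isFiniteMeasure_variation ν
  have hint := ν.integrable_rnDeriv ν.variation
  have h := Measure.variation_withDensityᵥ hint
  rw [withDensity_rnDeriv_variation] at h
  have h2 : ν.variation.withDensity 1 =
      ν.variation.withDensity fun x => ‖ν.rnDeriv ν.variation x‖ₑ := by
    rw [withDensity_one]; exact h
  have h3 := (withDensity_eq_iff aemeasurable_const hint.1.enorm
    (by simp [measure_ne_top])).1 h2
  filter_upwards [h3] with x hx
  have : ‖ν.rnDeriv ν.variation x‖ₑ = 1 := by simpa using hx.symm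
  rw [← toReal_enorm, this]; simp

/-- Integration against a complex measure is integration against its variation, with the
Radon-Nikodym derivative as weight. -/
lemma integral_eq_integral_mul_rnDeriv (ν : ComplexMeasure X) {f : X → ℂ}
    (hf : Integrable f ν.variation) :
    ν.integral f (ContinuousLinearMap.mul ℝ ℂ) =
      ∫ x, f x * ν.rnDeriv ν.variation x ∂ν.variation := by
  have := isFiniteMeasure_variation ν
  have hint := ν.integrable_rnDeriv ν.variation
  set h := ν.rnDeriv ν.variation with hh
  have hb : ∀ᵐ x ∂ν.variation, ‖h x‖ ≤ 1 :=
    (norm_rnDeriv_variation ν).mono fun x hx => hx.le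
  have hmul : ∀ {g : X → ℂ}, Integrable g ν.variation →
      Integrable (fun x => g x * h x) ν.variation := fun hg => hg.mul_bdd hint.1 hb
  refine Integrable.induction (P := fun f => ν.integral f (ContinuousLinearMap.mul ℝ ℂ) =
    ∫ x, f x * h x ∂ν.variation) ?_ ?_ ?_ ?_ hf
  · intro c s hs _
    rw [VectorMeasure.integral_indicator_const _ hs]
    have : (fun x => s.indicator (fun _ => c) x * h x) = s.indicator fun x => c * h x := by
      ext x; by_cases hx : x ∈ s <;> simp [hx]
    rw [this, integral_indicator hs, integral_const_mul]
    conv_lhs => rw [← withDensity_rnDeriv_variation ν]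
    rw [withDensityᵥ_apply hint hs]
    rfl
  · intro f g _ hf hg h1 h2
    rw [VectorMeasure.integral_add hf hg, h1, h2, ← integral_add (hmul hf) (hmul hg)]
    simp only [Pi.add_apply, add_mul]
  -- Both sides are continuous on `L¹`; the right one is 1-Lipschitz since `|h| ≤ 1`.
  · refine isClosed_eq VectorMeasure.continuous_integral ?_
    refine continuous_iff_continuousAt.2 fun f => ?_
    refine (LipschitzWith.of_dist_le_mul (K := 1) fun f g => ?_).continuous.continuousAt
    rw [dist_eq_norm, ← integral_sub (hmul (L1.integrable_coeFn f)) (hmul (L1.integrable_coeFn g)),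
      dist_eq_norm, L1.norm_eq_integral_norm, NNReal.coe_one, one_mul]
    refine norm_integral_le_of_norm_le (L1.integrable_coeFn _).norm ?_
    filter_upwards [hb, Lp.coeFn_sub f g] with x hx hx2
    rw [hx2, Pi.sub_apply, ← sub_mul, norm_mul]
    exact mul_le_of_le_one_right (norm_nonneg _) hx
  · intro f g hfg _ h1
    rw [← VectorMeasure.integral_congr_ae hfg, h1]
    exact integral_congr_ae (hfg.mono fun x hx => by simp only [hx])

end ComplexMeasure

/-! ### Characters and the smooth Bochner algebra. -/

/-- The character `z ↦ e^{i Re(z ā)}` of `ℂ`. -/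
noncomputable def char (a z : ℂ) : ℂ :=
  Complex.exp (Complex.I * (((z * conj a).re : ℝ) : ℂ))

@[simp] lemma norm_char (a z : ℂ) : ‖char a z‖ = 1 := by
  rw [char, mul_comm]; exact Complex.norm_exp_ofReal_mul_I _

lemma char_add (a b z : ℂ) : char (a + b) z = char a z * char b z := by
  simp only [char, ← Complex.exp_add, map_add, mul_add, Complex.add_re, Complex.ofReal_add]

lemma continuous_char : Continuous fun p : ℂ × ℂ => char p.1 p.2 := by
  unfold char; fun_prop

/-- A function in the smooth Bochner algebra is the Fourier transform of a bounded density with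
respect to a finite measure with bounded support. -/
lemma exists_density_of_mem_smoothBochner {φ : ℂ → ℂ} (hφ : φ ∈ smoothBochner) :
    ∃ (m : Measure ℂ) (h : ℂ → ℂ) (R : ℝ), IsFiniteMeasure m ∧ AEStronglyMeasurable h m ∧
      (∀ᵐ a ∂m, ‖h a‖ ≤ 1) ∧ (∀ᵐ a ∂m, ‖a‖ ≤ R) ∧ ∀ z, φ z = ∫ a, h a * char a z ∂m := by
  obtain ⟨ν, K, hK, hν, hφ⟩ := hφ
  have hfin := isFiniteMeasure_variation ν
  obtain ⟨R, hR⟩ := hK.isBounded.subset_closedBall 0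
  refine ⟨ν.variation, ν.rnDeriv ν.variation, R, hfin, (ν.integrable_rnDeriv _).1,
    (norm_rnDeriv_variation ν).mono fun x hx => hx.le, ?_, fun z => ?_⟩
  · have h0 : ν.variation Kᶜ = 0 :=
      (VectorMeasure.variation_apply_eq_zero hK.measurableSet.compl).2
        fun t ht htm => hν t htm (disjoint_compl_left.mono_left ht)
    filter_upwards [measure_eq_zero_iff_ae_notMem.1 h0] with a ha
    simpa using hR (not_not.1 ha)
  · rw [hφ, integral_eq_integral_mul_rnDeriv]
    · exact integral_congr_ae (.of_forall fun a => mul_comm _ _)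
    · refine (integrable_const (1 : ℝ)).mono' ?_ (.of_forall fun a => (norm_char a z).le)
      exact (continuous_char.comp (by fun_prop : Continuous fun a : ℂ => (a, z))).aestronglyMeasurable

/-! ### The Gaussian measure: total mass, rotations, mean values, exponential growth. -/

lemma measurable_gaussian_density :
    Measurable fun z : ℂ => ENNReal.ofReal (Real.pi⁻¹ * Real.exp (-‖z‖ ^ 2)) := by
  fun_prop

lemma integral_gaussian {E : Type*} [NormedAddCommGroup E] [NormedSpace ℝ E] (f : ℂ → E) :
    ∫ z, f z ∂gaussian = ∫ z, (Real.pi⁻¹ * Real.exp (-‖z‖ ^ 2)) • f z := by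
  rw [gaussian, integral_withDensity_eq_integral_toReal_smul measurable_gaussian_density
    (.of_forall fun z => ENNReal.ofReal_lt_top)]
  refine integral_congr_ae (.of_forall fun z => ?_)
  simp only
  rw [ENNReal.toReal_ofReal (by positivity)]

lemma integrable_gaussian_iff {E : Type*} [NormedAddCommGroup E] [NormedSpace ℝ E] {f : ℂ → E} :
    Integrable f gaussian ↔ Integrable fun z => (Real.pi⁻¹ * Real.exp (-‖z‖ ^ 2)) • f z := by
  rw [gaussian, integrable_withDensity_iff_integrable_smul' measurable_gaussian_density
    (.of_forall fun z => ENNReal.ofReal_lt_top)]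
  refine integrable_congr (.of_forall fun z => ?_)
  simp only
  rw [ENNReal.toReal_ofReal (by positivity)]

lemma integrable_exp_neg_mul_norm_sq {b : ℝ} (hb : 0 < b) :
    Integrable fun z : ℂ => Real.exp (-b * ‖z‖ ^ 2) := by
  have h := GaussianFourier.integrable_cexp_neg_mul_sq_norm_add (V := ℂ) (b := b)
    (by simpa using hb) 0 0
  refine h.norm.congr (.of_forall fun z => ?_)
  simp only [Complex.norm_exp]
  congr 1
  simp [← Complex.ofReal_pow]

instance : IsProbabilityMeasure gaussian := by
  constructor
  rw [gaussian, withDensity_apply _ MeasurableSet.univ, setLIntegral_univ,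
    ← ofReal_integral_eq_lintegral_ofReal, integral_const_mul]
  · have h := GaussianFourier.integral_rexp_neg_mul_sq_norm (V := ℂ) one_pos
    simp only [neg_mul, one_mul, Complex.finrank_real_complex, div_one, Nat.cast_ofNat] at h
    rw [h]
    norm_num [Real.pi_ne_zero]
  · have := (integrable_exp_neg_mul_norm_sq one_pos).const_mul Real.pi⁻¹
    simpa using this
  · exact .of_forall fun z => by positivity

lemma measurePreserving_mul_gaussian {u : ℂ} (hu : ‖u‖ = 1) :
    MeasurePreserving (fun w => u * w) gaussian gaussian := by
  have hv := (rotation ⟨u, mem_sphere_zero_iff_norm.2 hu⟩).measurePreserving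
  rw [show ⇑(rotation ⟨u, mem_sphere_zero_iff_norm.2 hu⟩) = fun w => u * w from rfl] at hv
  refine ⟨hv.measurable, ?_⟩
  ext s hs
  rw [Measure.map_apply hv.measurable hs, gaussian, withDensity_apply _ hs,
    withDensity_apply _ (hv.measurable hs),
    ← hv.setLIntegral_comp_preimage hs measurable_gaussian_density]
  simp [hu]

/-- The mean value property of entire functions for the Gaussian measure. -/
lemma integral_gaussian_eq_apply_zero {f : ℂ → ℂ} (hd : Differentiable ℂ f)
    (hi : Integrable f gaussian) : ∫ w, f w ∂gaussian = f 0 := by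
  have hrot : ∀ θ : ℝ, ∫ w, f (Complex.exp (θ * Complex.I) * w) ∂gaussian =
      ∫ w, f w ∂gaussian := fun θ =>
    (measurePreserving_mul_gaussian (Complex.norm_exp_ofReal_mul_I θ)).integral_comp'
      (f := (Homeomorph.mulLeft₀ _ (Complex.exp_ne_zero _)).toMeasurableEquiv) f
  have hprod : Integrable (Function.uncurry fun (θ : ℝ) w => f (Complex.exp (θ * Complex.I) * w))
      ((volume.restrict (uIoc 0 (2 * Real.pi))).prod gaussian) := by
    have hc : Continuous (Function.uncurry fun (θ : ℝ) w => f (Complex.exp (θ * Complex.I) * w)) :=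
      hd.continuous.comp (by fun_prop)
    rw [integrable_prod_iff hc.aestronglyMeasurable]
    have hn : ∀ θ : ℝ, MeasurePreserving (fun w => Complex.exp (θ * Complex.I) * w)
      gaussian gaussian := fun θ => measurePreserving_mul_gaussian (Complex.norm_exp_ofReal_mul_I θ)
    refine ⟨.of_forall fun θ => ((hn θ).integrable_comp hi.1).2 hi, ?_⟩
    have : ∀ θ : ℝ, ∫ w, ‖f (Complex.exp (θ * Complex.I) * w)‖ ∂gaussian =
        ∫ w, ‖f w‖ ∂gaussian := fun θ =>
      (hn θ).integral_comp'
        (f := (Homeomorph.mulLeft₀ _ (Complex.exp_ne_zero _)).toMeasurableEquiv) fun w => ‖f w‖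
    simp only [Function.uncurry, this]
    rw [uIoc_of_le (by positivity)]
    exact integrable_const _
  -- Averaging over rotations leaves the Gaussian integral unchanged; after Fubini the inner average
  -- over the circle through `w` is `f 0`.
  have hswap := intervalIntegral_integral_swap (f := fun (θ : ℝ) w =>
    f (Complex.exp (θ * Complex.I) * w)) (a := 0) (b := 2 * Real.pi) (μ := gaussian) hprod
  have hmean : ∀ w : ℂ, ∫ θ in (0 : ℝ)..2 * Real.pi, f (Complex.exp (θ * Complex.I) * w) =
      (2 * Real.pi : ℝ) • f 0 := by
    intro w
    have hg : Differentiable ℂ fun z => f (z * w) := hd.comp (by fun_prop)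
    have := hg.diffContOnCl.circleAverage (c := 0) (R := 1)
    rw [Real.circleAverage_def, zero_mul] at this
    rw [← this, smul_smul, mul_inv_cancel₀ (by positivity), one_smul]
    simp [circleMap]
  simp only [hrot, hmean] at hswap
  simpa [Real.pi_ne_zero] using hswap

lemma memLp_exp_norm (C : ℝ) : MemLp (fun w : ℂ => Real.exp (C * ‖w‖)) 2 gaussian := by
  have hc : Continuous fun w : ℂ => Real.exp (C * ‖w‖) := by fun_prop
  rw [memLp_two_iff_integrable_sq hc.aestronglyMeasurable, integrable_gaussian_iff]
  refine ((integrable_exp_neg_mul_norm_sq (b := 1 / 2) (by norm_num)).const_mul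
    (Real.pi⁻¹ * Real.exp (2 * C ^ 2))).mono' (by fun_prop) (.of_forall fun w => ?_)
  rw [norm_smul, Real.norm_of_nonneg (by positivity), Real.norm_of_nonneg (by positivity),
    mul_assoc, mul_assoc, ← Real.exp_nat_mul, ← Real.exp_add, ← Real.exp_add]
  -- This square gives `2C|w| - |w|² ≤ 2C² - |w|²/2`, whence the constant and the exponent `1/2`
  -- above.
  have : (0 : ℝ) ≤ (‖w‖ - 2 * C) ^ 2 := sq_nonneg _
  refine mul_le_mul_of_nonneg_left (Real.exp_le_exp.2 ?_) (by positivity)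
  push_cast
  nlinarith

lemma memLp_of_norm_le_exp {f : ℂ → ℂ} {A C : ℝ} (hf : AEStronglyMeasurable f gaussian)
    (h : ∀ w, ‖f w‖ ≤ A * Real.exp (C * ‖w‖)) : MemLp f 2 gaussian :=
  ((memLp_exp_norm C).const_mul A).of_le hf (.of_forall fun w => (h w).trans (le_abs_self _))

/-! ### The reproducing kernel and the action of character symbols. -/

lemma norm_exp_mul_conj_le (z w : ℂ) :
    ‖Complex.exp (z * conj w)‖ ≤ Real.exp (‖z‖ * ‖w‖) := by
  rw [Complex.norm_exp]
  gcongr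
  exact (Complex.re_le_norm _).trans (by simp)

lemma memLp_exp_mul_conj (z : ℂ) : MemLp (fun w => Complex.exp (z * conj w)) 2 gaussian :=
  memLp_of_norm_le_exp (A := 1) (by fun_prop : Continuous _).aestronglyMeasurable
    fun w => by simpa using norm_exp_mul_conj_le z w

lemma memLp_coherent (a : ℂ) : MemLp (coherent a) 2 gaussian :=
  memLp_of_norm_le_exp (A := 1) (C := ‖a‖)
    (by unfold coherent; fun_prop : Continuous _).aestronglyMeasurable
    fun w => by simpa [coherent, mul_comm] using norm_exp_mul_conj_le w a

lemma coherent_mem_fock (a : ℂ) : coherent a ∈ fock :=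
  ⟨by unfold coherent; fun_prop, memLp_coherent a⟩

lemma integrable_exp_mul {f : ℂ → ℂ} (hf : MemLp f 2 gaussian) (z : ℂ) :
    Integrable (fun w => Complex.exp (z * conj w) * f w) gaussian :=
  (memLp_exp_mul_conj z).integrable_mul hf

/-- The reproducing property of the kernel `e^{z w̄}`. -/
lemma integral_exp_mul_eq {f : ℂ → ℂ} (hd : Differentiable ℂ f) (z : ℂ)
    (hi : Integrable (fun w => Complex.exp (z * conj w) * f w) gaussian) :
    ∫ w, Complex.exp (z * conj w) * f w ∂gaussian = f z := by
  -- Recentring the Gaussian at `z` trades the antiholomorphic kernel for the holomorphic factor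
  -- `e^{-z̄ u}`, so the mean value property applies at `u = 0`.
  have key : ∀ u : ℂ, (Real.pi⁻¹ * Real.exp (-‖z + u‖ ^ 2)) •
      (Complex.exp (z * conj (z + u)) * f (z + u)) =
      (Real.pi⁻¹ * Real.exp (-‖u‖ ^ 2)) • (Complex.exp (-(conj z * u)) * f (z + u)) := by
    intro u
    simp only [Complex.real_smul, Complex.ofReal_mul, mul_assoc]
    congr 1
    rw [← mul_assoc, ← mul_assoc, Complex.ofReal_exp, Complex.ofReal_exp, ← Complex.exp_add,
      ← Complex.exp_add]
    congr 2
    push_cast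
    rw [← Complex.mul_conj', ← Complex.mul_conj', map_add]
    ring
  have hi' := integrable_gaussian_iff.1 hi
  rw [integral_gaussian, ← integral_add_left_eq_self _ z]
  simp only [key]
  rw [← integral_gaussian fun u => Complex.exp (-(conj z * u)) * f (z + u)]
  have hd' : Differentiable ℂ fun u => Complex.exp (-(conj z * u)) * f (z + u) := by fun_prop
  rw [integral_gaussian_eq_apply_zero hd']
  · simp
  · rw [integrable_gaussian_iff]
    simp only [← key]
    exact hi'.comp_add_left z

/-- The symbol `e^{i Re(w ā)}` induces a weighted shift. -/
lemma toeplitz_char {f : ℂ → ℂ} (hf : f ∈ fock) (a z : ℂ) :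
    ∫ w, char a w * (Complex.exp (z * conj w) * f w) ∂gaussian =
      Complex.exp (Complex.I * z * conj a / 2 - a * conj a / 4) * f (z + Complex.I * a / 2) := by
  -- In `Re(w ā) = (w ā + w̄ a)/2`, the `w̄` half moves the kernel point to `z + i a/2`, while the
  -- `w` half is absorbed into the entire function.
  have key : ∀ w, char a w * (Complex.exp (z * conj w) * f w) =
      Complex.exp ((z + Complex.I * a / 2) * conj w) *
        (Complex.exp (Complex.I * w * conj a / 2) * f w) := by
    intro w
    rw [← mul_assoc, ← mul_assoc, char, ← Complex.exp_add, ← Complex.exp_add]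
    congr 2
    have : (((w * conj a).re : ℝ) : ℂ) = (w * conj a + conj w * a) / 2 := by
      rw [Complex.re_eq_add_conj]; simp
    rw [this]; ring
  have hi : Integrable (fun w => char a w * (Complex.exp (z * conj w) * f w)) gaussian := by
    refine (integrable_exp_mul hf.2 z).bdd_mul (c := 1) ?_ (.of_forall fun w => (norm_char a w).le)
    exact (continuous_char.comp (by fun_prop : Continuous fun w : ℂ => (a, w))).aestronglyMeasurable
  simp only [key] at hi ⊢
  have hd := hf.1
  rw [integral_exp_mul_eq (by fun_prop) _ hi]
  congr 2
  linear_combination (conj a * a / 4) * Complex.I_sq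

/-- The action of a Toeplitz operator whose symbol is a superposition of characters. -/
lemma toeplitz_integral_char {X : Type*} [MeasurableSpace X] {m : Measure X} [SFinite m]
    {c p : X → ℂ} (hc : Integrable c m) (hp : Measurable p) {f : ℂ → ℂ} (hf : f ∈ fock) (z : ℂ) :
    toeplitz (fun w => ∫ x, c x * char (p x) w ∂m) f z =
      ∫ x, c x * (Complex.exp (Complex.I * z * conj (p x) / 2 - p x * conj (p x) / 4) *
        f (z + Complex.I * p x / 2)) ∂m := by
  have h1 : ∀ w, (∫ x, c x * char (p x) w ∂m) * Complex.exp (z * conj w) * f w =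
      ∫ x, c x * (char (p x) w * (Complex.exp (z * conj w) * f w)) ∂m := by
    intro w
    rw [mul_assoc, ← integral_mul_const]
    simp only [mul_assoc]
  simp only [toeplitz, h1]
  rw [integral_integral_swap]
  · simp only [integral_const_mul, toeplitz_char hf]
  · have h2 := ((integrable_exp_mul hf.2 z).mul_prod hc)
    have h3 := h2.bdd_mul (c := 1) (f := fun q : ℂ × X => char (p q.2) q.1)
      (continuous_char.measurable.comp
        ((hp.comp measurable_snd).prodMk measurable_fst)).aestronglyMeasurable
      (.of_forall fun q => (norm_char _ _).le)
    refine h3.congr (.of_forall fun q => ?_)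
    simp only [Function.uncurry]
    ring

/-! ### Bounded symbols: domains, holomorphy and boundedness. -/

lemma mem_toeplitzDom_of_bounded {φ : ℂ → ℂ} {M : ℝ} (hφ : AEStronglyMeasurable φ gaussian)
    (hM : ∀ w, ‖φ w‖ ≤ M) {f : ℂ → ℂ} (hf : f ∈ fock) : f ∈ toeplitzDom φ :=
  ⟨hf, hf.2.of_le_mul (hφ.mul hf.2.1) (.of_forall fun w => by
    rw [norm_mul]; exact mul_le_mul_of_nonneg_right (hM w) (norm_nonneg _))⟩

lemma toeplitzDom_eq_fock {φ : ℂ → ℂ} {M : ℝ} (hφ : AEStronglyMeasurable φ gaussian)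
    (hM : ∀ w, ‖φ w‖ ≤ M) : toeplitzDom φ = fock :=
  Subset.antisymm (fun _ hf => hf.1) fun _ hf => mem_toeplitzDom_of_bounded hφ hM hf

lemma differentiable_toeplitz {φ : ℂ → ℂ} {M : ℝ} (hφ : AEStronglyMeasurable φ gaussian)
    (hM : ∀ w, ‖φ w‖ ≤ M) {f : ℂ → ℂ} (hf : MemLp f 2 gaussian) :
    Differentiable ℂ (toeplitz φ f) := by
  intro z
  have hint : ∀ ζ, Integrable (fun w => φ w * Complex.exp (ζ * conj w) * f w) gaussian := by
    intro ζ
    simp only [mul_assoc]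
    exact (integrable_exp_mul hf ζ).bdd_mul hφ (.of_forall hM)
  -- In `‖z‖ + 2`, one unit is the radius of the ball around `z`, the other absorbs the factor `w̄`
  -- of the derivative through `|w| ≤ e^{|w|}`.
  have hb : Integrable (fun w => M * (Real.exp ((‖z‖ + 2) * ‖w‖) * ‖f w‖)) gaussian :=
    ((memLp_exp_norm (‖z‖ + 2)).integrable_mul hf.norm).const_mul M
  refine (hasDerivAt_integral_of_dominated_loc_of_deriv_le (𝕜 := ℂ) (x₀ := z)
    (F' := fun ζ w => φ w * (Complex.exp (ζ * conj w) * conj w) * f w)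
    (Metric.ball_mem_nhds z one_pos)
    (.of_forall fun ζ => (hint ζ).1) (hint z) ?_ (.of_forall fun w ζ hζ => ?_) hb
    (.of_forall fun w ζ _ => ?_)).2.differentiableAt
  · exact (hφ.mul (by fun_prop : Continuous fun w : ℂ =>
      Complex.exp (z * conj w) * conj w).aestronglyMeasurable).mul hf.1
  · have hζ' : ‖ζ‖ ≤ ‖z‖ + 1 := by
      have := norm_sub_norm_le ζ z
      have h2 : ‖ζ - z‖ < 1 := by simpa [dist_eq_norm] using hζ
      linarith
    have hw : ‖w‖ ≤ Real.exp ‖w‖ := by linarith [Real.add_one_le_exp ‖w‖]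
    have h3 : ‖Complex.exp (ζ * conj w) * conj w‖ ≤ Real.exp ((‖z‖ + 2) * ‖w‖) := by
      rw [norm_mul, RCLike.norm_conj]
      calc _ ≤ Real.exp (‖ζ‖ * ‖w‖) * Real.exp ‖w‖ :=
            mul_le_mul (norm_exp_mul_conj_le ζ w) hw (norm_nonneg _) (Real.exp_nonneg _)
        _ = Real.exp ((‖ζ‖ + 1) * ‖w‖) := by rw [← Real.exp_add]; ring_nf
        _ ≤ _ := Real.exp_le_exp.2 (mul_le_mul_of_nonneg_right (by linarith) (norm_nonneg _))
    rw [norm_mul, norm_mul, mul_assoc]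
    have hM0 : 0 ≤ M := (norm_nonneg _).trans (hM w)
    exact mul_le_mul (hM w) (mul_le_mul_of_nonneg_right h3 (norm_nonneg _)) (by positivity) hM0
  · have h1 : HasDerivAt (fun ζ : ℂ => Complex.exp (ζ * conj w))
        (Complex.exp (ζ * conj w) * conj w) ζ := by
      simpa using ((hasDerivAt_id ζ).mul_const (conj w)).cexp
    exact (h1.const_mul (φ w)).mul_const (f w)

/-- Complete the square. Thus `e^{|w|²/2}` is an eigenfunction of the positive kernel `|e^{z w̄}|`
with eigenvalue `2`, which makes it the weight for Schur's test. -/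
lemma lintegral_exp_re_mul_conj (z : ℂ) :
    ∫⁻ w, ENNReal.ofReal (Real.exp ((z * conj w).re + ‖w‖ ^ 2 / 2)) ∂gaussian =
      2 * ENNReal.ofReal (Real.exp (‖z‖ ^ 2 / 2)) := by
  have key : ∀ w : ℂ, (Real.pi⁻¹ * Real.exp (-‖w‖ ^ 2)) •
      Real.exp ((z * conj w).re + ‖w‖ ^ 2 / 2) =
      Real.pi⁻¹ * Real.exp (‖z‖ ^ 2 / 2) * Real.exp (-(1 / 2) * ‖w - z‖ ^ 2) := by
    intro w
    rw [smul_eq_mul, mul_assoc, mul_assoc, ← Real.exp_add, ← Real.exp_add]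
    congr 2
    have : ‖w - z‖ ^ 2 = ‖w‖ ^ 2 + ‖z‖ ^ 2 - 2 * (z * conj w).re := by
      simp only [← Complex.normSq_eq_norm_sq, Complex.normSq_sub]
      simp only [Complex.mul_re, Complex.conj_re, Complex.conj_im]
      ring
    rw [this]; ring
  rw [← ofReal_integral_eq_lintegral_ofReal]
  · rw [integral_gaussian]
    simp only [key]
    rw [integral_const_mul, integral_sub_right_eq_self (fun w : ℂ => Real.exp (-(1 / 2) * ‖w‖ ^ 2)),
      GaussianFourier.integral_rexp_neg_mul_sq_norm (by norm_num),
      show (2 : ℝ≥0∞) = ENNReal.ofReal 2 by simp, ← ENNReal.ofReal_mul (by norm_num)]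
    congr 1
    simp only [Complex.finrank_real_complex]
    norm_num
    field_simp
  · rw [integrable_gaussian_iff]
    simp only [key]
    exact ((integrable_exp_neg_mul_norm_sq (b := 1 / 2) (by norm_num)).comp_sub_right z).const_mul _
  · exact .of_forall fun w => (Real.exp_pos _).le

/-- Schur's estimate for the kernel `|e^{z w̄}|`. -/
lemma lintegral_enorm_exp_mul_sq_le {f : ℂ → ℂ} (hf : Measurable f) :
    ∫⁻ z, (∫⁻ w, ‖Complex.exp (z * conj w)‖ₑ * ‖f w‖ₑ ∂gaussian) ^ 2 ∂gaussian ≤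
      4 * ∫⁻ w, ‖f w‖ₑ ^ 2 ∂gaussian := by
  set A : ℝ → ℝ≥0∞ := fun t => ENNReal.ofReal (Real.exp t) with hA
  have hAadd : ∀ s t, A s * A t = A (s + t) := fun s t => by
    simp only [hA]; rw [← ENNReal.ofReal_mul (Real.exp_nonneg _), ← Real.exp_add]
  have hAsq : ∀ s, A s ^ 2 = A (2 * s) := fun s => by rw [sq, hAadd]; ring_nf
  have hAm : Measurable A := by fun_prop
  have hfm : Measurable fun w => ‖f w‖ₑ := hf.enorm
  have hpt : ∀ z, (∫⁻ w, ‖Complex.exp (z * conj w)‖ₑ * ‖f w‖ₑ ∂gaussian) ^ 2 ≤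
      2 * A (‖z‖ ^ 2 / 2) *
        ∫⁻ w, A ((z * conj w).re - ‖w‖ ^ 2 / 2) * ‖f w‖ₑ ^ 2 ∂gaussian := by
    intro z
    -- Cauchy-Schwarz with the kernel split into two square roots, weighted by `e^{±|w|²/4}`; the
    -- square of the first factor integrates to the eigenfunction.
    have h1 : ∀ w, ‖Complex.exp (z * conj w)‖ₑ * ‖f w‖ₑ =
        A ((z * conj w).re / 2 + ‖w‖ ^ 2 / 4) *
          (A ((z * conj w).re / 2 - ‖w‖ ^ 2 / 4) * ‖f w‖ₑ) := by
      intro w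
      rw [← mul_assoc, hAadd, ← ofReal_norm, Complex.norm_exp]
      simp only [hA]; ring_nf
    have h2 := ENNReal.lintegral_mul_le_Lp_mul_Lq gaussian Real.HolderConjugate.two_two
      (f := fun w => A ((z * conj w).re / 2 + ‖w‖ ^ 2 / 4))
      (g := fun w => A ((z * conj w).re / 2 - ‖w‖ ^ 2 / 4) * ‖f w‖ₑ)
      (by fun_prop) (by fun_prop)
    simp only [h1]
    refine (pow_le_pow_left₀ zero_le h2 2).trans (le_of_eq ?_)
    rw [mul_pow, ← ENNReal.rpow_natCast, ← ENNReal.rpow_natCast, ← ENNReal.rpow_mul,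
      ← ENNReal.rpow_mul]
    norm_num
    congr 1
    · rw [← lintegral_exp_re_mul_conj]
      refine lintegral_congr fun w => ?_
      rw [hAsq]
      simp only [hA, Complex.mul_re, Complex.conj_re, Complex.conj_im]
      ring_nf
    · refine lintegral_congr fun w => ?_
      rw [mul_pow, hAsq]; ring_nf
  calc _ ≤ ∫⁻ z, ∫⁻ w, 2 * (A (‖z‖ ^ 2 / 2) *
          (A ((z * conj w).re - ‖w‖ ^ 2 / 2) * ‖f w‖ₑ ^ 2)) ∂gaussian ∂gaussian := by
        refine lintegral_mono fun z => (hpt z).trans (le_of_eq ?_)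
        rw [mul_assoc, ← lintegral_const_mul _ (by fun_prop), ← lintegral_const_mul _ (by fun_prop)]
    _ = ∫⁻ w, ∫⁻ z, 2 * (A (‖z‖ ^ 2 / 2) *
          (A ((z * conj w).re - ‖w‖ ^ 2 / 2) * ‖f w‖ₑ ^ 2)) ∂gaussian ∂gaussian := by
        refine lintegral_lintegral_swap (Measurable.aemeasurable ?_)
        simp only [Function.uncurry_def]
        fun_prop
    _ = ∫⁻ w, 4 * ‖f w‖ₑ ^ 2 ∂gaussian := by
        refine lintegral_congr fun w => ?_
        -- The kernel is symmetric, so the `z`-integral is the same eigenfunction integral; the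
        -- weights in `w` then cancel and leave `2 · 2 = 4`.
        have h3 : ∀ z, 2 * (A (‖z‖ ^ 2 / 2) *
            (A ((z * conj w).re - ‖w‖ ^ 2 / 2) * ‖f w‖ₑ ^ 2)) =
            (2 * A (-(‖w‖ ^ 2 / 2)) * ‖f w‖ₑ ^ 2) * A ((w * conj z).re + ‖z‖ ^ 2 / 2) := by
          intro z
          have : (w * conj z).re = (z * conj w).re := by simp [mul_comm]
          rw [this, ← mul_assoc (A _), hAadd]
          have : A (‖z‖ ^ 2 / 2 + ((z * conj w).re - ‖w‖ ^ 2 / 2)) =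
            A (-(‖w‖ ^ 2 / 2)) * A ((z * conj w).re + ‖z‖ ^ 2 / 2) := by rw [hAadd]; ring_nf
          rw [this]; ring
        simp only [h3]
        rw [lintegral_const_mul _ (by fun_prop), lintegral_exp_re_mul_conj]
        have h4 : A (-(‖w‖ ^ 2 / 2)) * A (‖w‖ ^ 2 / 2) = 1 := by rw [hAadd]; simp [hA]
        calc _ = 4 * ‖f w‖ₑ ^ 2 * (A (-(‖w‖ ^ 2 / 2)) * A (‖w‖ ^ 2 / 2)) := by ring
          _ = _ := by rw [h4, mul_one]
    _ = _ := lintegral_const_mul _ (by fun_prop)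

/-- A bounded symbol induces a bounded operator. -/
lemma eLpNorm_toeplitz_le {φ : ℂ → ℂ} {M : ℝ≥0} (hM : ∀ w, ‖φ w‖ ≤ M) {f : ℂ → ℂ}
    (hf : f ∈ fock) :
    eLpNorm (toeplitz φ f) 2 gaussian ≤ ((2 * M : ℝ≥0) : ℝ≥0∞) * eLpNorm f 2 gaussian := by
  have hle : ∀ z, ‖toeplitz φ f z‖ₑ ≤
      M * ∫⁻ w, ‖Complex.exp (z * conj w)‖ₑ * ‖f w‖ₑ ∂gaussian := by
    intro z
    rw [← lintegral_const_mul' _ _ ENNReal.coe_ne_top]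
    refine (enorm_integral_le_lintegral_enorm _).trans (lintegral_mono fun w => ?_)
    rw [enorm_mul, enorm_mul, mul_assoc]
    gcongr
    exact ENNReal.coe_le_coe.2 (hM w)
  have hsq : ∀ g : ℂ → ℂ, eLpNorm g 2 gaussian ^ 2 = ∫⁻ z, ‖g z‖ₑ ^ 2 ∂gaussian := by
    intro g
    have := eLpNorm_nnreal_pow_eq_lintegral (p := 2) (f := g) (μ := gaussian) two_ne_zero
    simpa using this
  rw [← ENNReal.pow_le_pow_left_iff two_ne_zero, mul_pow, hsq, hsq]
  calc _ ≤ ∫⁻ z, (M * ∫⁻ w, ‖Complex.exp (z * conj w)‖ₑ * ‖f w‖ₑ ∂gaussian) ^ 2 ∂gaussian := by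
        gcongr with z; exact hle z
    _ = M ^ 2 * ∫⁻ z, (∫⁻ w, ‖Complex.exp (z * conj w)‖ₑ * ‖f w‖ₑ ∂gaussian) ^ 2 ∂gaussian := by
        simp only [mul_pow]
        exact lintegral_const_mul' _ _ (by finiteness)
    _ ≤ M ^ 2 * (4 * ∫⁻ w, ‖f w‖ₑ ^ 2 ∂gaussian) := by
        gcongr; exact lintegral_enorm_exp_mul_sq_le hf.1.continuous.measurable
    _ = _ := by push_cast; ring

lemma toeplitz_mem_fock {φ : ℂ → ℂ} {M : ℝ≥0} (hφ : AEStronglyMeasurable φ gaussian)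
    (hM : ∀ w, ‖φ w‖ ≤ M) {f : ℂ → ℂ} (hf : f ∈ fock) : toeplitz φ f ∈ fock := by
  have hd := differentiable_toeplitz hφ hM hf.2
  refine ⟨hd, hd.continuous.aestronglyMeasurable, (eLpNorm_toeplitz_le hM hf).trans_lt ?_⟩
  exact ENNReal.mul_lt_top ENNReal.coe_lt_top hf.2.2

/-! ### Fourier transforms of bounded densities and their Wirtinger derivatives. -/

/-- The Fourier transform `z ↦ ∫ h(a) e^{i Re(z ā)} dm(a)` of the measure `h m`. -/
noncomputable def fourierDensity (m : Measure ℂ) (h : ℂ → ℂ) : ℂ → ℂ :=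
  fun z => ∫ a, h a * char a z ∂m

/-- `h` is a bounded measurable density with respect to `m`. -/
def IsBoundedDensity {X : Type*} [MeasurableSpace X] (m : Measure X) (h : X → ℂ) : Prop :=
  AEStronglyMeasurable h m ∧ ∃ B : ℝ, ∀ᵐ a ∂m, ‖h a‖ ≤ B

lemma IsBoundedDensity.integrable {X : Type*} [MeasurableSpace X] {m : Measure X}
    [IsFiniteMeasure m] {h : X → ℂ} (hh : IsBoundedDensity m h) : Integrable h m := by
  obtain ⟨hm, B, hB⟩ := hh
  exact (integrable_const B).mono' hm hB

lemma IsBoundedDensity.mul {X : Type*} [MeasurableSpace X] {m : Measure X} {g h : X → ℂ}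
    (hg : IsBoundedDensity m g) (hh : IsBoundedDensity m h) :
    IsBoundedDensity m fun a => g a * h a := by
  obtain ⟨hm, B, hB⟩ := hh
  obtain ⟨gm, C, hC⟩ := hg
  refine ⟨gm.mul hm, C * B, ?_⟩
  filter_upwards [hB, hC] with a h1 h2
  rw [norm_mul]
  exact mul_le_mul h2 h1 (norm_nonneg _) ((norm_nonneg _).trans h2)

section

variable {m : Measure ℂ} [IsFiniteMeasure m] {R : ℝ} {h : ℂ → ℂ}

/-- The bilinear form for which `VectorFourier.fourierIntegral` is `fourierDensity`. -/
noncomputable def pairing : ℂ →L[ℝ] ℂ →L[ℝ] ℝ := (-(2 * Real.pi)⁻¹) • innerSL ℝ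

lemma pairing_apply (a z : ℂ) : pairing a z = -(2 * Real.pi)⁻¹ * (z * conj a).re := by
  have : innerSL ℝ a z = (z * conj a).re := by
    rw [innerSL_apply_apply, Complex.inner, mul_comm]
  rw [pairing, smul_apply, smul_apply, this, smul_eq_mul]

/-- The factor `-(2π)⁻¹` in `pairing` cancels the sign and the `2π` in the convention `e^{-2πi L(a,
z)}`. -/
lemma fourierChar_pairing (a z : ℂ) :
    ((Real.fourierChar (-pairing a z) : Circle) : ℂ) = char a z := by
  rw [Real.fourierChar_apply, pairing_apply, char]
  congr 1
  push_cast
  field_simp [Real.pi_ne_zero]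

lemma fourierDensity_eq_fourierIntegral (m : Measure ℂ) (h : ℂ → ℂ) :
    fourierDensity m h =
      VectorFourier.fourierIntegral Real.fourierChar m pairing.toLinearMap₁₂ h := by
  ext z
  refine integral_congr_ae (.of_forall fun a => ?_)
  have : pairing.toLinearMap₁₂ a z = pairing a z := rfl
  simp only
  rw [this, Circle.smul_def, fourierChar_pairing, smul_eq_mul, mul_comm]

/-- Finiteness of all moments is what permits differentiating the Fourier transform arbitrarily
often. -/
lemma integrable_pow_norm_mul (hR : ∀ᵐ a ∂m, ‖a‖ ≤ R) (hh : IsBoundedDensity m h) (n : ℕ) :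
    Integrable (fun a => ‖a‖ ^ n * ‖h a‖) m := by
  refine hh.integrable.norm.bdd_mul (c := R ^ n)
    (by fun_prop : Continuous fun a : ℂ => ‖a‖ ^ n).aestronglyMeasurable ?_
  filter_upwards [hR] with a ha
  rw [norm_pow, norm_norm]
  exact pow_le_pow_left₀ (norm_nonneg _) ha n

lemma contDiff_fourierDensity (hR : ∀ᵐ a ∂m, ‖a‖ ≤ R) (hh : IsBoundedDensity m h) :
    ContDiff ℝ ∞ (fourierDensity m h) := by
  rw [fourierDensity_eq_fourierIntegral]
  exact VectorFourier.contDiff_fourierIntegral pairing fun n _ => integrable_pow_norm_mul hR hh n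

omit [IsFiniteMeasure m] in
lemma isBoundedDensity_const_mul {l : ℂ → ℂ} (hl : Continuous l) {C : ℝ}
    (hC : ∀ a, ‖l a‖ ≤ C * ‖a‖) (hR : ∀ᵐ a ∂m, ‖a‖ ≤ R) : IsBoundedDensity m l := by
  refine ⟨hl.aestronglyMeasurable, |C| * R, ?_⟩
  filter_upwards [hR] with a ha
  exact (hC a).trans ((mul_le_mul_of_nonneg_right (le_abs_self C) (norm_nonneg a)).trans
    (mul_le_mul_of_nonneg_left ha (abs_nonneg C)))

lemma fderiv_fourierDensity_apply (hR : ∀ᵐ a ∂m, ‖a‖ ≤ R) (hh : IsBoundedDensity m h) (z v : ℂ) :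
    fderiv ℝ (fourierDensity m h) z v =
      ∫ a, (Complex.I * ((v * conj a).re : ℝ)) * h a * char a z ∂m := by
  have h1 : Integrable (fun a => ‖a‖ * ‖h a‖) m := by
    simpa using integrable_pow_norm_mul hR hh 1
  have h2 : Integrable (fun a => VectorFourier.fourierSMulRight pairing h a) m :=
    (h1.const_mul (2 * Real.pi * ‖pairing‖)).mono' hh.integrable.1.fourierSMulRight
      (.of_forall fun a => (VectorFourier.norm_fourierSMulRight_le pairing h a).trans_eq (by ring))
  rw [fourierDensity_eq_fourierIntegral, VectorFourier.fderiv_fourierIntegral pairing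
    hh.integrable h1]
  refine (VectorFourier.fourierIntegral_continuousLinearMap_apply
    Real.continuous_fourierChar h2).trans ?_
  refine integral_congr_ae (.of_forall fun a => ?_)
  have : pairing.toLinearMap₁₂ a z = pairing a z := rfl
  simp only
  rw [this, Circle.smul_def, fourierChar_pairing, VectorFourier.fourierSMulRight_apply,
    pairing_apply]
  simp only [smul_eq_mul, Complex.real_smul]
  push_cast
  field_simp [Real.pi_ne_zero]

lemma integrable_mul_char (hh : IsBoundedDensity m h) (z : ℂ) :
    Integrable (fun a => h a * char a z) m :=
  hh.integrable.mul_bdd (c := 1)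
    (continuous_char.comp (by fun_prop : Continuous fun a : ℂ => (a, z))).aestronglyMeasurable
    (.of_forall fun a => (norm_char a z).le)

omit [IsFiniteMeasure m] in
lemma isBoundedDensity_re_mul (hR : ∀ᵐ a ∂m, ‖a‖ ≤ R) (hh : IsBoundedDensity m h) (v : ℂ) :
    IsBoundedDensity m fun a => (Complex.I * ((v * conj a).re : ℝ)) * h a := by
  refine (isBoundedDensity_const_mul (C := ‖v‖) (by fun_prop) (fun a => ?_) hR).mul hh
  simp only [norm_mul, Complex.norm_I, one_mul, Complex.norm_real, Real.norm_eq_abs]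
  exact (Complex.abs_re_le_norm _).trans (by simp)

/-- The directions `1` and `i` contribute `i Re a` and `i Im a`, and `Re a - i Im a = ā`. The
opposite sign in `dzbar` yields `a`. -/
lemma dz_fourierDensity (hR : ∀ᵐ a ∂m, ‖a‖ ≤ R) (hh : IsBoundedDensity m h) :
    dz (fourierDensity m h) = fourierDensity m fun a => (Complex.I * conj a / 2) * h a := by
  ext z
  rw [dz, fderiv_fourierDensity_apply hR hh, fderiv_fourierDensity_apply hR hh,
    ← integral_const_mul, ← integral_sub (integrable_mul_char (isBoundedDensity_re_mul hR hh _) z)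
      ((integrable_mul_char (isBoundedDensity_re_mul hR hh _) z).const_mul _),
    ← integral_const_mul]
  refine integral_congr_ae (.of_forall fun a => ?_)
  have : conj a = (a.re : ℂ) - a.im * Complex.I := by
    apply Complex.ext <;> simp
  simp only [this]
  simp
  ring

lemma dzbar_fourierDensity (hR : ∀ᵐ a ∂m, ‖a‖ ≤ R) (hh : IsBoundedDensity m h) :
    dzbar (fourierDensity m h) = fourierDensity m fun a => (Complex.I * a / 2) * h a := by
  ext z
  rw [dzbar, fderiv_fourierDensity_apply hR hh, fderiv_fourierDensity_apply hR hh,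
    ← integral_const_mul, ← integral_add (integrable_mul_char (isBoundedDensity_re_mul hR hh _) z)
      ((integrable_mul_char (isBoundedDensity_re_mul hR hh _) z).const_mul _),
    ← integral_const_mul]
  refine integral_congr_ae (.of_forall fun a => ?_)
  have h1 : conj a = (a.re : ℂ) - a.im * Complex.I := by
    apply Complex.ext <;> simp
  simp only [h1]
  simp
  linear_combination (Complex.I * h a * char a z / 2) * Complex.re_add_im a

omit [IsFiniteMeasure m] in
lemma isBoundedDensity_pow_mul {l : ℂ → ℂ} (hl : IsBoundedDensity m l)
    (hh : IsBoundedDensity m h) (k : ℕ) : IsBoundedDensity m fun a => l a ^ k * h a := by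
  induction k with
  | zero => simpa using hh
  | succ k ih => simpa only [pow_succ', mul_assoc] using hl.mul ih

omit [IsFiniteMeasure m] in
lemma isBoundedDensity_I_mul_conj (hR : ∀ᵐ a ∂m, ‖a‖ ≤ R) :
    IsBoundedDensity m fun a => Complex.I * conj a / 2 :=
  isBoundedDensity_const_mul (C := 1 / 2) (by fun_prop) (fun a => by simp; linarith) hR

omit [IsFiniteMeasure m] in
lemma isBoundedDensity_I_mul (hR : ∀ᵐ a ∂m, ‖a‖ ≤ R) :
    IsBoundedDensity m fun a => Complex.I * a / 2 :=
  isBoundedDensity_const_mul (C := 1 / 2) (by fun_prop) (fun a => by simp; linarith) hR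

lemma dz_iterate_fourierDensity (hR : ∀ᵐ a ∂m, ‖a‖ ≤ R) (hh : IsBoundedDensity m h) (k : ℕ) :
    dz^[k] (fourierDensity m h) = fourierDensity m fun a => (Complex.I * conj a / 2) ^ k * h a := by
  induction k with
  | zero => simp
  | succ k ih =>
    rw [Function.iterate_succ_apply', ih, dz_fourierDensity hR
      (isBoundedDensity_pow_mul (isBoundedDensity_I_mul_conj hR) hh k)]
    simp only [pow_succ', mul_assoc]

lemma dzbar_iterate_fourierDensity (hR : ∀ᵐ a ∂m, ‖a‖ ≤ R) (hh : IsBoundedDensity m h) (k : ℕ) :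
    dzbar^[k] (fourierDensity m h) = fourierDensity m fun a => (Complex.I * a / 2) ^ k * h a := by
  induction k with
  | zero => simp
  | succ k ih =>
    rw [Function.iterate_succ_apply', ih, dzbar_fourierDensity hR
      (isBoundedDensity_pow_mul (isBoundedDensity_I_mul hR) hh k)]
    simp only [pow_succ', mul_assoc]

omit [IsFiniteMeasure m] in
lemma exists_norm_fourierDensity_le (m : Measure ℂ) (h : ℂ → ℂ) :
    ∃ M : ℝ≥0, ∀ z, ‖fourierDensity m h z‖ ≤ M := by
  refine ⟨⟨∫ a, ‖h a‖ ∂m, integral_nonneg fun a => norm_nonneg _⟩, fun z => ?_⟩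
  refine (norm_integral_le_integral_norm _).trans_eq ?_
  simp only [norm_mul, norm_char, mul_one]
  rfl

end

/-! ### Behaviour of the Wirtinger derivatives under rotation. -/

section Rotation

/-- A general multiplier `c` is allowed because derivatives of a rotation-invariant function are
only equivariant; this form can be iterated. -/
lemma dz_mul_of_norm_eq_one {f : ℂ → ℂ} (hf : Differentiable ℝ f) {u c : ℂ} (hu : ‖u‖ = 1)
    (h : ∀ z, f (u * z) = c * f z) (z : ℂ) :
    dz f (u * z) = (c * conj u) * dz f z ∧ dzbar f (u * z) = (c * u) * dzbar f z := by
  have key : ∀ v, fderiv ℝ f (u * z) (u * v) = c * fderiv ℝ f z v := by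
    intro v
    have h1 : HasFDerivAt (fun z => f (u * z))
        ((fderiv ℝ f (u * z)).comp (ContinuousLinearMap.mul ℝ ℂ u)) z :=
      (hf (u * z)).hasFDerivAt.comp z (ContinuousLinearMap.mul ℝ ℂ u).hasFDerivAt
    have h2 : HasFDerivAt (fun z => f (u * z)) (c • fderiv ℝ f z) z := by
      simp only [h]
      exact (hf z).hasFDerivAt.const_mul c
    exact congrArg (fun L : ℂ →L[ℝ] ℂ => L v) (h1.unique h2)
  set D := fderiv ℝ f (u * z) with hD
  have hlin : ∀ w : ℂ, D w = w.re * D 1 + w.im * D Complex.I := by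
    intro w
    have : w = w.re • (1 : ℂ) + w.im • Complex.I := by simp
    conv_lhs => rw [this, map_add, map_smul, map_smul]
    simp
  have k1 := key 1
  have k2 := key Complex.I
  rw [hlin] at k1 k2
  simp only [mul_one, Complex.mul_re, Complex.I_re, mul_zero, Complex.I_im, zero_sub,
    Complex.mul_im, add_zero, Complex.ofReal_neg] at k1 k2
  have huu : u * conj u = 1 := by rw [Complex.mul_conj, Complex.normSq_eq_norm_sq, hu]; simp
  have hure : u = (u.re : ℂ) + u.im * Complex.I := (Complex.re_add_im u).symm
  have hcre : conj u = (u.re : ℂ) - u.im * Complex.I := by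
    apply Complex.ext <;> simp
  -- The combinations `D 1 ∓ i D i` diagonalise precomposition with `u`, with eigenvalues `u` and
  -- `ū`.
  have e1 : u * (D 1 - Complex.I * D Complex.I) =
      c * (fderiv ℝ f z 1 - Complex.I * fderiv ℝ f z Complex.I) := by
    have : u * (D 1 - Complex.I * D Complex.I) =
      ((u.re : ℂ) + u.im * Complex.I) * (D 1 - Complex.I * D Complex.I) := by rw [← hure]
    rw [this]
    linear_combination k1 - Complex.I * k2 - u.im * D Complex.I * Complex.I_sq
  have e2 : conj u * (D 1 + Complex.I * D Complex.I) =
      c * (fderiv ℝ f z 1 + Complex.I * fderiv ℝ f z Complex.I) := by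
    rw [hcre]
    linear_combination k1 + Complex.I * k2 - u.im * D Complex.I * Complex.I_sq
  simp only [dz, dzbar, ← hD]
  constructor
  · linear_combination (conj u / 2) * e1 - (D 1 - Complex.I * D Complex.I) / 2 * huu
  · linear_combination (u / 2) * e2 - (D 1 + Complex.I * D Complex.I) / 2 * huu

/-- The `k`-fold derivatives pick up `ū^k` and `u^k`, whose product is `1`. -/
lemma diamondTerm_mul_of_norm_eq_one {φ ψ : ℂ → ℂ} (hφ : ∀ k, Differentiable ℝ (dz^[k] φ))
    (hψ : ∀ k, Differentiable ℝ (dzbar^[k] ψ)) {u : ℂ} (hu : ‖u‖ = 1)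
    (hφu : ∀ z, φ (u * z) = φ z) (hψu : ∀ z, ψ (u * z) = ψ z) (k : ℕ) (z : ℂ) :
    diamondTerm φ ψ k (u * z) = diamondTerm φ ψ k z := by
  have h1 : ∀ k, ∀ z, dz^[k] φ (u * z) = conj u ^ k * dz^[k] φ z := by
    intro k
    induction k with
    | zero => simpa using hφu
    | succ k ih =>
      intro z
      simp only [Function.iterate_succ_apply']
      rw [(dz_mul_of_norm_eq_one (hφ k) hu ih z).1, pow_succ]
  have h2 : ∀ k, ∀ z, dzbar^[k] ψ (u * z) = u ^ k * dzbar^[k] ψ z := by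
    intro k
    induction k with
    | zero => simpa using hψu
    | succ k ih =>
      intro z
      simp only [Function.iterate_succ_apply']
      rw [(dz_mul_of_norm_eq_one (hψ k) hu ih z).2, pow_succ]
  have huu : conj u ^ k * u ^ k = 1 := by
    rw [← mul_pow, mul_comm, Complex.mul_conj, Complex.normSq_eq_norm_sq, hu]; simp
  rw [diamondTerm, diamondTerm, h1, h2]
  linear_combination ((-1) ^ k / (k.factorial : ℂ) * (dz^[k] φ z * dzbar^[k] ψ z)) * huu

end Rotation

/-! ### The composition symbol and the series `φ ⋄ ψ`. -/

section Composition

variable {m n : Measure ℂ} [IsFiniteMeasure m] [IsFiniteMeasure n] {R S : ℝ} {h g : ℂ → ℂ}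

/-- The symbol of the composition of the Toeplitz operators with symbols `fourierDensity m h`
and `fourierDensity n g`. -/
noncomputable def compositionSymbol (m n : Measure ℂ) (h g : ℂ → ℂ) : ℂ → ℂ := fun z =>
  ∫ p : ℂ × ℂ, (Complex.exp (conj p.1 * p.2 / 4) * (h p.1 * g p.2)) * char (p.1 + p.2) z ∂m.prod n

omit [IsFiniteMeasure m] [IsFiniteMeasure n] in
lemma isBoundedDensity_prod (hh : IsBoundedDensity m h) (hg : IsBoundedDensity n g) :
    IsBoundedDensity (m.prod n) fun p : ℂ × ℂ => h p.1 * g p.2 := by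
  obtain ⟨hm, B, hB⟩ := hh
  obtain ⟨gm, C, hC⟩ := hg
  exact IsBoundedDensity.mul ⟨hm.comp_fst, B, Measure.quasiMeasurePreserving_fst.ae hB⟩
    ⟨gm.comp_snd, C, Measure.quasiMeasurePreserving_snd.ae hC⟩

omit [IsFiniteMeasure m] [IsFiniteMeasure n] in
lemma ae_prod_norm_le (hR : ∀ᵐ a ∂m, ‖a‖ ≤ R) (hS : ∀ᵐ b ∂n, ‖b‖ ≤ S) :
    ∀ᵐ p ∂m.prod n, ‖conj p.1 * p.2 / 4‖ ≤ R * S / 4 := by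
  filter_upwards [Measure.quasiMeasurePreserving_fst.ae hR,
    Measure.quasiMeasurePreserving_snd.ae hS] with p h1 h2
  rw [norm_div, norm_mul, RCLike.norm_conj, Complex.norm_ofNat]
  have := mul_le_mul h1 h2 (norm_nonneg _) ((norm_nonneg _).trans h1)
  linarith

omit [IsFiniteMeasure m] [IsFiniteMeasure n] in
lemma isBoundedDensity_exp_mul (hR : ∀ᵐ a ∂m, ‖a‖ ≤ R) (hS : ∀ᵐ b ∂n, ‖b‖ ≤ S)
    (hh : IsBoundedDensity m h) (hg : IsBoundedDensity n g) :
    IsBoundedDensity (m.prod n) fun p : ℂ × ℂ =>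
      Complex.exp (conj p.1 * p.2 / 4) * (h p.1 * g p.2) := by
  refine IsBoundedDensity.mul ⟨(by fun_prop : Continuous _).aestronglyMeasurable,
    Real.exp (R * S / 4), ?_⟩ (isBoundedDensity_prod hh hg)
  filter_upwards [ae_prod_norm_le hR hS] with p hp
  rw [Complex.norm_exp]
  exact Real.exp_le_exp.2 ((Complex.re_le_norm _).trans hp)

/-- The sign `(-1)^k` cancels `i^{2k}`: `(-1)^k (i ā/2)^k (i b/2)^k = (ā b/4)^k`. -/
lemma diamondTerm_fourierDensity (hR : ∀ᵐ a ∂m, ‖a‖ ≤ R) (hS : ∀ᵐ b ∂n, ‖b‖ ≤ S)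
    (hh : IsBoundedDensity m h) (hg : IsBoundedDensity n g) (k : ℕ) (z : ℂ) :
    diamondTerm (fourierDensity m h) (fourierDensity n g) k z =
      ∫ p : ℂ × ℂ, (conj p.1 * p.2 / 4) ^ k / (k.factorial : ℂ) *
        (h p.1 * g p.2 * char (p.1 + p.2) z) ∂m.prod n := by
  rw [diamondTerm, dz_iterate_fourierDensity hR hh, dzbar_iterate_fourierDensity hS hg,
    fourierDensity, fourierDensity, ← integral_prod_mul, ← integral_const_mul]
  refine integral_congr_ae (.of_forall fun p => ?_)
  have : (-1 : ℂ) ^ k * ((Complex.I * conj p.1 / 2) ^ k * (Complex.I * p.2 / 2) ^ k) =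
      (conj p.1 * p.2 / 4) ^ k := by
    rw [← mul_pow, ← mul_pow]
    congr 1
    linear_combination (-(conj p.1 * p.2 / 4)) * Complex.I_sq
  simp only
  rw [← this, char_add]
  ring

/-- The series defining `φ ⋄ ψ` converges pointwise to the composition symbol. -/
lemma hasSum_diamondTerm (hR : ∀ᵐ a ∂m, ‖a‖ ≤ R) (hS : ∀ᵐ b ∂n, ‖b‖ ≤ S)
    (hh : IsBoundedDensity m h) (hg : IsBoundedDensity n g) (z : ℂ) :
    HasSum (fun k => diamondTerm (fourierDensity m h) (fourierDensity n g) k z)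
      (compositionSymbol m n h g z) := by
  simp only [diamondTerm_fourierDensity hR hS hh hg]
  set G : ℂ × ℂ → ℂ := fun p => h p.1 * g p.2 * char (p.1 + p.2) z with hG
  have hcm : AEStronglyMeasurable (fun p : ℂ × ℂ => char (p.1 + p.2) z) (m.prod n) :=
    (continuous_char.comp
      (by fun_prop : Continuous fun p : ℂ × ℂ => (p.1 + p.2, z))).aestronglyMeasurable
  have hGi : Integrable G (m.prod n) :=
    (isBoundedDensity_prod hh hg).integrable.mul_bdd (c := 1) hcm
      (.of_forall fun p => (norm_char _ z).le)
  have hle : ∀ k : ℕ, ∀ᵐ p ∂m.prod n,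
      ‖(conj p.1 * p.2 / 4) ^ k / (k.factorial : ℂ)‖ ≤ (R * S / 4) ^ k / k.factorial := by
    intro k
    filter_upwards [ae_prod_norm_le hR hS] with p hp
    rw [norm_div, norm_pow, Complex.norm_natCast]
    gcongr
  have hFi : ∀ k : ℕ, Integrable (fun p : ℂ × ℂ =>
      (conj p.1 * p.2 / 4) ^ k / (k.factorial : ℂ) * G p) (m.prod n) := fun k =>
    hGi.bdd_mul (by fun_prop : Continuous _).aestronglyMeasurable (hle k)
  -- Bounded supports dominate the `L¹` norms by the exponential series at `R S/4`, so sum and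
  -- integral may be exchanged.
  have hsum : Summable fun k : ℕ => ∫ p : ℂ × ℂ,
      ‖(conj p.1 * p.2 / 4) ^ k / (k.factorial : ℂ) * G p‖ ∂m.prod n := by
    refine Summable.of_nonneg_of_le (fun k => integral_nonneg fun p => norm_nonneg _)
      (fun k => ?_) ((Real.summable_pow_div_factorial (R * S / 4)).mul_right
        (∫ p, ‖G p‖ ∂m.prod n))
    rw [← integral_const_mul]
    refine integral_mono_ae (hFi k).norm (hGi.norm.const_mul _) ?_
    filter_upwards [hle k] with p hp
    rw [norm_mul]
    exact mul_le_mul_of_nonneg_right hp (norm_nonneg _)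
  have key := hasSum_integral_of_summable_integral_norm hFi hsum
  suffices h : compositionSymbol m n h g z = ∫ p : ℂ × ℂ, ∑' k : ℕ,
      (conj p.1 * p.2 / 4) ^ k / (k.factorial : ℂ) * G p ∂m.prod n by rw [h]; exact key
  refine integral_congr_ae (.of_forall fun p => ?_)
  simp only
  rw [tsum_mul_right, Complex.exp_eq_exp_ℂ, NormedSpace.exp_eq_tsum_div, hG]
  ring

lemma continuous_fourierIntegral_char {X : Type*} [MeasurableSpace X] {m : Measure X}
    {c p : X → ℂ} (hc : Integrable c m) (hp : Measurable p) :
    Continuous fun z => ∫ x, c x * char (p x) z ∂m := by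
  refine continuous_of_dominated (bound := fun x => ‖c x‖) (fun z => ?_)
    (fun z => .of_forall fun x => by simp) hc.norm (.of_forall fun x => ?_)
  · exact hc.1.mul (continuous_char.measurable.comp
      (hp.prodMk measurable_const)).aestronglyMeasurable
  · exact continuous_const.mul
      (continuous_char.comp (by fun_prop : Continuous fun z : ℂ => (p x, z)))

lemma continuous_compositionSymbol (hR : ∀ᵐ a ∂m, ‖a‖ ≤ R) (hS : ∀ᵐ b ∂n, ‖b‖ ≤ S)
    (hh : IsBoundedDensity m h) (hg : IsBoundedDensity n g) :
    Continuous (compositionSymbol m n h g) :=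
  continuous_fourierIntegral_char (isBoundedDensity_exp_mul hR hS hh hg).integrable
    (by fun_prop : Measurable fun p : ℂ × ℂ => p.1 + p.2)

omit [IsFiniteMeasure m] [IsFiniteMeasure n] in
lemma exists_norm_compositionSymbol_le (m n : Measure ℂ) (h g : ℂ → ℂ) :
    ∃ M : ℝ≥0, ∀ z, ‖compositionSymbol m n h g z‖ ≤ M := by
  refine ⟨⟨∫ p : ℂ × ℂ, ‖Complex.exp (conj p.1 * p.2 / 4) * (h p.1 * g p.2)‖ ∂m.prod n,
    integral_nonneg fun a => norm_nonneg _⟩, fun z => ?_⟩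
  refine (norm_integral_le_integral_norm _).trans_eq ?_
  refine integral_congr_ae (.of_forall fun p => ?_)
  simp only
  rw [norm_mul, norm_char, mul_one]

/-- The composition of two Toeplitz operators whose symbols are Fourier transforms of compactly
supported measures. -/
lemma toeplitz_compositionSymbol (hR : ∀ᵐ a ∂m, ‖a‖ ≤ R) (hS : ∀ᵐ b ∂n, ‖b‖ ≤ S)
    (hh : IsBoundedDensity m h) (hg : IsBoundedDensity n g) {f : ℂ → ℂ} (hf : f ∈ fock) :
    toeplitz (compositionSymbol m n h g) f =
      toeplitz (fourierDensity m h) (toeplitz (fourierDensity n g) f) := by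
  ext z
  obtain ⟨M, hM⟩ := exists_norm_fourierDensity_le n g
  have hcont : Continuous (fourierDensity n g) := (contDiff_fourierDensity hS hg).continuous
  have hTf : toeplitz (fourierDensity n g) f ∈ fock :=
    toeplitz_mem_fock hcont.aestronglyMeasurable hM hf
  have hc := (isBoundedDensity_exp_mul hR hS hh hg)
  have h1 := toeplitz_integral_char hh.integrable measurable_id hTf z
  have h2 := fun ζ => toeplitz_integral_char hg.integrable measurable_id hf ζ
  have h3 := toeplitz_integral_char hc.integrable
    (by fun_prop : Measurable fun p : ℂ × ℂ => p.1 + p.2) hf z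
  simp only [id] at h1 h2
  change toeplitz (compositionSymbol m n h g) f z = _ at h3
  change toeplitz (fourierDensity m h) _ z = _ at h1
  change ∀ ζ, toeplitz (fourierDensity n g) f ζ = _ at h2
  rw [h1, h3, integral_prod]
  · refine integral_congr_ae (.of_forall fun a => ?_)
    simp only
    rw [h2, ← integral_const_mul, ← integral_const_mul]
    refine integral_congr_ae (.of_forall fun b => ?_)
    simp only
    -- The cocycle identity of the weighted shifts: expanding `|a + b|²` produces both cross terms,
    -- and `e^{ā b/4}` removes the one absent from the composition.
    have he : Complex.exp (conj a * b / 4) *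
        Complex.exp (Complex.I * z * conj (a + b) / 2 - (a + b) * conj (a + b) / 4) =
        Complex.exp (Complex.I * z * conj a / 2 - a * conj a / 4) *
        Complex.exp (Complex.I * (z + Complex.I * a / 2) * conj b / 2 - b * conj b / 4) := by
      rw [← Complex.exp_add, ← Complex.exp_add, map_add]
      congr 1
      linear_combination (-(a * conj b / 4)) * Complex.I_sq
    have hz : z + Complex.I * (a + b) / 2 = z + Complex.I * a / 2 + Complex.I * b / 2 := by ring
    rw [hz]
    linear_combination (h a * g b * f (z + Complex.I * a / 2 + Complex.I * b / 2)) * he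
  -- Fubini's hypothesis: for fixed `z` the shifted points stay in a compact ball on which `f` is
  -- bounded, and the weight is bounded as well.
  · refine hc.integrable.mul_bdd (c := Real.exp (‖z‖ * (|R| + |S|)) *
      sSup ((fun w => ‖f w‖) '' Metric.closedBall 0 (‖z‖ + (|R| + |S|)))) ?_ ?_
    · have := hf.1.continuous
      exact (by fun_prop : Continuous _).aestronglyMeasurable
    · filter_upwards [Measure.quasiMeasurePreserving_fst.ae hR,
        Measure.quasiMeasurePreserving_snd.ae hS] with p hp1 hp2
      have hp : ‖p.1 + p.2‖ ≤ |R| + |S| :=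
        (norm_add_le _ _).trans (add_le_add (hp1.trans (le_abs_self _)) (hp2.trans (le_abs_self _)))
      rw [norm_mul]
      refine mul_le_mul ?_ ?_ (norm_nonneg _) (Real.exp_nonneg _)
      · rw [Complex.norm_exp, Complex.sub_re]
        refine Real.exp_le_exp.2 ?_
        have e1 : (Complex.I * z * conj (p.1 + p.2) / 2).re ≤ ‖z‖ * (|R| + |S|) := by
          refine (Complex.re_le_norm _).trans ?_
          rw [norm_div, norm_mul, norm_mul, Complex.norm_I, RCLike.norm_conj, Complex.norm_ofNat,
            one_mul]
          have := mul_le_mul_of_nonneg_left hp (norm_nonneg z)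
          have : 0 ≤ ‖z‖ * ‖p.1 + p.2‖ := by positivity
          linarith
        have e2 : 0 ≤ ((p.1 + p.2) * conj (p.1 + p.2) / 4).re := by
          rw [Complex.mul_conj, ← Complex.ofReal_ofNat, ← Complex.ofReal_div, Complex.ofReal_re]
          have := Complex.normSq_nonneg (p.1 + p.2)
          positivity
        linarith
      · refine le_csSup ((isCompact_closedBall _ _).bddAbove_image
          hf.1.continuous.norm.continuousOn) ⟨_, ?_, rfl⟩
        rw [mem_closedBall_zero_iff]
        refine (norm_add_le _ _).trans ?_
        rw [norm_div, norm_mul, Complex.norm_I, Complex.norm_ofNat, one_mul]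
        have := norm_nonneg (p.1 + p.2)
        linarith

end Composition

/-! ### Growth conditions for bounded continuous radial symbols. -/

lemma radial_ofReal (a : ℝ → ℂ) {r : ℝ} (hr : 0 ≤ r) : radial a (r : ℂ) = a r := by
  rw [radial, Complex.norm_of_nonneg hr]

lemma radial_mul_of_norm_eq_one (a : ℝ → ℂ) {u : ℂ} (hu : ‖u‖ = 1) (z : ℂ) :
    radial a (u * z) = radial a z := by
  rw [radial, radial, norm_mul, hu, one_mul]

section

variable {a : ℝ → ℂ} {M : ℝ}

lemma aestronglyMeasurable_of_continuous_radial (hc : Continuous (radial a)) :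
    AEStronglyMeasurable a (volume.restrict (Ioi 0)) := by
  refine (hc.comp Complex.continuous_ofReal).aestronglyMeasurable.congr ?_
  filter_upwards [ae_restrict_mem measurableSet_Ioi] with r hr
  exact radial_ofReal a (le_of_lt hr)

lemma norm_le_of_norm_radial_le (hM : ∀ z, ‖radial a z‖ ≤ M) {r : ℝ} (hr : 0 ≤ r) : ‖a r‖ ≤ M :=
  radial_ofReal a hr ▸ hM r

lemma integrableOn_exp_neg_sq_mul_pow (n : ℕ) :
    IntegrableOn (fun r : ℝ => Real.exp (-r ^ 2) * r ^ n) (Ioi 0) := by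
  have h := integrable_rpow_mul_exp_neg_mul_sq one_pos (s := n)
    (by linarith [(Nat.cast_nonneg n : (0 : ℝ) ≤ n)])
  refine h.integrableOn.congr_fun (fun r _ => ?_) measurableSet_Ioi
  simp [mul_comm]

lemma memL1Infty_of_bounded (hc : Continuous (radial a)) (hM : ∀ z, ‖radial a z‖ ≤ M) :
    MemL1Infty a := by
  have hm := aestronglyMeasurable_of_continuous_radial hc
  refine ⟨hm, fun n => ?_⟩
  simp only [mul_assoc]
  refine (integrableOn_exp_neg_sq_mul_pow n).bdd_mul (c := M) hm.norm ?_
  filter_upwards [ae_restrict_mem measurableSet_Ioi] with r hr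
  rw [norm_norm]
  exact norm_le_of_norm_radial_le hM (le_of_lt hr)

lemma memL2Infty_of_bounded (hc : Continuous (radial a)) (hM : ∀ z, ‖radial a z‖ ≤ M) :
    MemL2Infty a := by
  have hm := aestronglyMeasurable_of_continuous_radial hc
  refine ⟨hm, fun n => ?_⟩
  simp only [mul_assoc]
  refine (integrableOn_exp_neg_sq_mul_pow (n + 1)).bdd_mul (c := M ^ 2) (hm.norm.pow 2) ?_
  filter_upwards [ae_restrict_mem measurableSet_Ioi] with r hr
  rw [norm_pow, norm_norm]
  exact pow_le_pow_left₀ (norm_nonneg _) (norm_le_of_norm_radial_le hM (le_of_lt hr)) 2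

/-- `γ_a(n)` averages `a(√r)` against the probability density `rⁿ e^{-r}/n!`. -/
lemma norm_gam_le (hM : ∀ z, ‖radial a z‖ ≤ M) (n : ℕ) : ‖gam a n‖ ≤ M := by
  have hG : ∫ r in Ioi (0 : ℝ), r ^ n * Real.exp (-r) = n.factorial := by
    rw [← Real.Gamma_nat_eq_factorial, Real.Gamma_eq_integral (by positivity)]
    refine setIntegral_congr_fun measurableSet_Ioi fun r _ => ?_
    simp [mul_comm]
  have hGi : IntegrableOn (fun r : ℝ => r ^ n * Real.exp (-r)) (Ioi 0) := by
    refine (Real.GammaIntegral_convergent (s := n + 1) (by positivity)).congr_fun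
      (fun r _ => ?_) measurableSet_Ioi
    simp [mul_comm]
  have h : ‖∫ r in Ioi (0 : ℝ), a (Real.sqrt r) * ((r ^ n * Real.exp (-r) : ℝ) : ℂ)‖ ≤
      ∫ r in Ioi (0 : ℝ), M * (r ^ n * Real.exp (-r)) := by
    refine norm_integral_le_of_norm_le (hGi.const_mul M) ?_
    filter_upwards [ae_restrict_mem measurableSet_Ioi] with r hr
    have hr' : (0 : ℝ) < r := hr
    rw [norm_mul, Complex.norm_real, Real.norm_of_nonneg (by positivity)]
    gcongr
    exact norm_le_of_norm_radial_le hM (Real.sqrt_nonneg r)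
  rw [integral_const_mul, hG] at h
  rw [gam, norm_mul, norm_div, norm_one, Complex.norm_natCast, one_div, inv_mul_le_iff₀
    (by positivity), mul_comm]
  exact h

lemma integrableOn_exp_mul_mul_exp_neg_sq (x : ℝ) :
    IntegrableOn (fun r : ℝ => Real.exp (x * r) * (Real.exp (-r ^ 2) * r)) (Ioi 0) := by
  refine ((integrable_exp_neg_mul_sq (b := 1 / 2) (by norm_num)).const_mul
    (Real.exp ((x + 1) ^ 2 / 2))).integrableOn.mono'
    (by fun_prop : Continuous _).aestronglyMeasurable ?_
  filter_upwards [ae_restrict_mem measurableSet_Ioi] with r hr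
  have hr' : (0 : ℝ) < r := hr
  rw [Real.norm_of_nonneg (by positivity)]
  calc _ ≤ Real.exp (x * r) * (Real.exp (-r ^ 2) * Real.exp r) := by
        gcongr; linarith [Real.add_one_le_exp r]
    _ = Real.exp (x * r + (-r ^ 2 + r)) := by rw [Real.exp_add, Real.exp_add]
    _ ≤ Real.exp ((x + 1) ^ 2 / 2 + -(1 / 2) * r ^ 2) :=
        Real.exp_le_exp.2 (by nlinarith [sq_nonneg (r - (x + 1))])
    _ = _ := Real.exp_add _ _

/-- The terms are nonnegative, and under the integral their partial sums are dominated through `∑ (x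
r)ⁿ/n! ≤ e^{x r}`, which the Gaussian absorbs. -/
lemma summable_pow_mul_q (hc : Continuous (radial a)) (hM : ∀ z, ‖radial a z‖ ≤ M) {x : ℝ}
    (hx : 0 ≤ x) : Summable fun n : ℕ => x ^ n * q a n / (n.factorial : ℝ) := by
  have hint := (memL2Infty_of_bounded hc hM).2
  have hq : ∀ n, 0 ≤ q a n := fun n =>
    setIntegral_nonneg measurableSet_Ioi fun r hr => by
      have hr' : (0 : ℝ) < r := hr
      positivity
  refine summable_of_sum_le (c := ∫ r in Ioi (0 : ℝ),
    M ^ 2 * (Real.exp (x * r) * (Real.exp (-r ^ 2) * r)))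
    (fun n => div_nonneg (mul_nonneg (pow_nonneg hx n) (hq n)) (Nat.cast_nonneg _)) fun u => ?_
  have h1 : ∀ n, x ^ n * q a n / (n.factorial : ℝ) = ∫ r in Ioi (0 : ℝ),
      x ^ n / (n.factorial : ℝ) * (‖a r‖ ^ 2 * Real.exp (-r ^ 2) * r ^ (n + 1)) := by
    intro n
    rw [integral_const_mul, q]; ring
  simp only [h1]
  rw [← integral_finsetSum _ fun n _ => (hint n).const_mul _]
  refine setIntegral_mono_on (integrable_finsetSum _ fun n _ => (hint n).const_mul _)
    ((integrableOn_exp_mul_mul_exp_neg_sq x).const_mul _) measurableSet_Ioi fun r hr => ?_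
  have hr' : (0 : ℝ) < r := hr
  have h2 : ∑ n ∈ u, (x * r) ^ n / (n.factorial : ℝ) ≤ Real.exp (x * r) := by
    rw [Real.exp_eq_exp_ℝ]
    exact sum_le_hasSum _ (fun n _ => by positivity)
      (NormedSpace.expSeries_div_hasSum_exp (x * r))
  calc _ = ‖a r‖ ^ 2 * ((∑ n ∈ u, (x * r) ^ n / (n.factorial : ℝ)) *
          (Real.exp (-r ^ 2) * r)) := by
        rw [Finset.sum_mul, Finset.mul_sum]
        refine Finset.sum_congr rfl fun n _ => ?_
        ring
    _ ≤ _ := by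
        gcongr
        exact norm_le_of_norm_radial_le hM hr'.le

end

/-- The hypotheses of the composition theorem hold for bounded continuous radial symbols. -/
lemma compositionHypotheses_of_bounded {φ ψ : ℝ → ℂ} {M N : ℝ≥0} (hφ : Continuous (radial φ))
    (hψ : Continuous (radial ψ)) (hM : ∀ z, ‖radial φ z‖ ≤ M) (hN : ∀ z, ‖radial ψ z‖ ≤ N) :
    CompositionHypotheses φ ψ where
  toeplitz_left a := mem_toeplitzDom_of_bounded hφ.aestronglyMeasurable hM (coherent_mem_fock a)
  toeplitz_right a := mem_toeplitzDom_of_bounded hψ.aestronglyMeasurable hN (coherent_mem_fock a)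
  memL1_left := memL1Infty_of_bounded hφ hM
  memL1_right := memL1Infty_of_bounded hψ hN
  bounded_right := ⟨2 * N, fun _ hf => eLpNorm_toeplitz_le hN hf.1⟩
  bounded_gam := ⟨M * N, fun n => by
    rw [norm_mul]
    exact mul_le_mul (norm_gam_le hM n) (norm_gam_le hN n) (norm_nonneg _) M.coe_nonneg⟩
  memL2_left := memL2Infty_of_bounded hφ hM
  summable_left _ hx := summable_pow_mul_q hφ hM hx

/-! ### Uniqueness of the symbol. -/

open scoped FourierTransform in
/-- Injectivity of the Fourier transform on integrable functions on `ℂ`. -/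
lemma ae_eq_zero_of_integral_mul_char_eq_zero {u : ℂ → ℂ} (hu : Integrable u)
    (h : ∀ ξ, ∫ w, char ξ w * u w = 0) : ∀ᵐ w, u w = 0 := by
  have hF : VectorFourier.fourierIntegral Real.fourierChar volume (innerₗ ℂ).flip u = 0 := by
    ext ξ
    rw [Pi.zero_apply, ← h ((-(2 * Real.pi) : ℝ) * ξ)]
    refine integral_congr_ae (.of_forall fun w => ?_)
    simp only
    rw [Circle.smul_def, smul_eq_mul, Real.fourierChar_apply, char]
    congr 2
    have h1 : (innerₗ ℂ).flip w ξ = (w * conj ξ).re := by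
      rw [LinearMap.flip_apply, innerₗ_apply_apply, Complex.inner, mul_comm]
    have h2 : (w * conj ((-(2 * Real.pi) : ℝ) * ξ)).re = -(2 * Real.pi) * (w * conj ξ).re := by
      rw [map_mul, Complex.conj_ofReal, mul_left_comm, Complex.re_ofReal_mul]
    rw [h1, h2]
    push_cast
    ring
  refine ae_eq_zero_of_integral_contDiff_smul_eq_zero hu.locallyIntegrable fun g hg hgc => ?_
  have hg₁ : HasCompactSupport (Complex.ofRealCLM ∘ g) := hgc.comp_left rfl
  have hg₂ : ContDiff ℝ ∞ (Complex.ofRealCLM ∘ g) := by fun_prop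
  set G := hg₁.toSchwartzMap hg₂
  -- Each test function is the Fourier transform of a Schwartz function, so the multiplication
  -- formula moves the transform onto `u`, where it vanishes.
  have hG : ∀ x, VectorFourier.fourierIntegral Real.fourierChar volume (innerₗ ℂ)
      (𝓕⁻ G : SchwartzMap ℂ ℂ) x = (g x : ℂ) := by
    intro x
    have : (𝓕 (𝓕⁻ G : SchwartzMap ℂ ℂ) : SchwartzMap ℂ ℂ) x = G x := by
      rw [FourierTransform.fourier_fourierInv_eq]
    rw [SchwartzMap.fourier_coe] at this
    exact this
  have hflip := VectorFourier.integral_fourierIntegral_smul_eq_flip (μ := volume) (ν := volume)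
    (L := innerₗ ℂ) Real.continuous_fourierChar continuous_inner
    (𝓕⁻ G : SchwartzMap ℂ ℂ).integrable hu
  rw [hF] at hflip
  simp only [hG] at hflip
  simpa using hflip

/-- A symbol is determined by the action of its Toeplitz operator on the coherent states. -/
lemma ae_eq_of_toeplitz_coherent_eq {σ τ : ℂ → ℂ} (hσ : IsToeplitz σ) (hτ : IsToeplitz τ)
    (h : ∀ a, toeplitz σ (coherent a) = toeplitz τ (coherent a)) : ∀ᵐ z, σ z = τ z := by
  have hint : ∀ {σ : ℂ → ℂ}, IsToeplitz σ → ∀ a z, Integrable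
      (fun w => σ w * Complex.exp (z * conj w) * coherent a w) gaussian := by
    intro σ hσ a z
    refine (integrable_exp_mul (hσ a).2 z).congr (.of_forall fun w => ?_)
    simp only
    ring
  set u : ℂ → ℂ := fun w => (Real.pi⁻¹ * Real.exp (-‖w‖ ^ 2)) • (σ w - τ w) with hu
  have hui : Integrable u := by
    rw [← integrable_gaussian_iff]
    refine ((hint hσ 0 0).sub (hint hτ 0 0)).congr (.of_forall fun w => ?_)
    simp [coherent]
  have hzero : ∀ ξ, ∫ w, char ξ w * u w = 0 := by
    intro ξ
    -- With these parameters the product `e^{z w̄} K_a(w)` is exactly the character of frequency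
    -- `ξ`.
    have h1 := congrFun (h (-(Complex.I * ξ / 2))) (Complex.I * ξ / 2)
    rw [toeplitz, toeplitz, ← sub_eq_zero, ← integral_sub (hint hσ _ _) (hint hτ _ _),
      integral_gaussian] at h1
    rw [← h1]
    refine integral_congr_ae (.of_forall fun w => ?_)
    have hchar : char ξ w = Complex.exp (Complex.I * ξ / 2 * conj w) *
        coherent (-(Complex.I * ξ / 2)) w := by
      rw [char, coherent, ← Complex.exp_add]
      congr 1
      have : (((w * conj ξ).re : ℝ) : ℂ) = (w * conj ξ + conj w * ξ) / 2 := by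
        rw [Complex.re_eq_add_conj]; simp
      rw [this]
      simp only [map_neg, map_div₀, map_mul, Complex.conj_I, map_ofNat]
      ring
    simp only [hu, hchar, Complex.real_smul]
    ring
  filter_upwards [ae_eq_zero_of_integral_mul_char_eq_zero hui hzero] with w hw
  have hpos : Real.pi⁻¹ * Real.exp (-‖w‖ ^ 2) ≠ 0 := by positivity
  exact sub_eq_zero.1 ((smul_eq_zero.1 hw).resolve_left hpos)

end SegalBargmann

/-! ### Assembly of the proposition. -/

theorem mainTheorem3 (φ ψ : ℝ → ℂ)
    (hφ : SegalBargmann.radial φ ∈ SegalBargmann.smoothBochner)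
    (hψ : SegalBargmann.radial ψ ∈ SegalBargmann.smoothBochner) :
    -- the terms of `φ ⋄ ψ` are honest derivatives, and the series converges pointwise
    (ContDiff ℝ ∞ (SegalBargmann.radial φ) ∧ ContDiff ℝ ∞ (SegalBargmann.radial ψ) ∧
      ∀ z : ℂ, Summable (fun k : ℕ =>
        SegalBargmann.diamondTerm (SegalBargmann.radial φ) (SegalBargmann.radial ψ) k z)) ∧
    -- the pair satisfies the hypotheses of the composition theorem
    SegalBargmann.CompositionHypotheses φ ψ ∧
    -- the theorem's symbol exists, and any such symbol equals `φ ⋄ ψ` almost everywhere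
    (∃ τ : ℝ → ℂ, SegalBargmann.IsCompositionSymbol φ ψ τ) ∧
    ∀ τ : ℝ → ℂ, SegalBargmann.IsCompositionSymbol φ ψ τ →
      ∀ᵐ z : ℂ, SegalBargmann.radial τ z =
        SegalBargmann.diamond (SegalBargmann.radial φ) (SegalBargmann.radial ψ) z := by
  open SegalBargmann in
  obtain ⟨m, h, R, _, hm, hh1, hR, hφm⟩ := exists_density_of_mem_smoothBochner hφ
  obtain ⟨n, g, S, _, hn, hg1, hS, hψn⟩ := exists_density_of_mem_smoothBochner hψ
  replace hφm : radial φ = fourierDensity m h := funext hφm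
  replace hψn : radial ψ = fourierDensity n g := funext hψn
  have hh : IsBoundedDensity m h := ⟨hm, 1, hh1⟩
  have hg : IsBoundedDensity n g := ⟨hn, 1, hg1⟩
  have hφd : ContDiff ℝ ∞ (radial φ) := hφm ▸ contDiff_fourierDensity hR hh
  have hψd : ContDiff ℝ ∞ (radial ψ) := hψn ▸ contDiff_fourierDensity hS hg
  obtain ⟨M, hM⟩ := exists_norm_fourierDensity_le m h
  obtain ⟨N, hN⟩ := exists_norm_fourierDensity_le n g
  obtain ⟨B, hB⟩ := exists_norm_compositionSymbol_le m n h g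
  rw [← hφm] at hM
  rw [← hψn] at hN
  have hsum := hasSum_diamondTerm hR hS hh hg
  have hc := continuous_compositionSymbol hR hS hh hg
  have hcomp := fun f hf => toeplitz_compositionSymbol hR hS hh hg (f := f) hf
  rw [← hφm, ← hψn] at hsum hcomp
  set D := compositionSymbol m n h g
  have hdiamond : ∀ z, diamond (radial φ) (radial ψ) z = D z := fun z => (hsum z).tsum_eq
  -- The profile of `D` is its restriction to the real axis; rotation invariance is read off the
  -- series, since it is not visible from the double integral.
  have hrad : radial (fun r => D (r : ℂ)) = D := by
    ext z
    obtain ⟨u, hu⟩ : ∃ u : ℂ, ‖u‖ = 1 ∧ z = u * (‖z‖ : ℝ) :=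
      ⟨Complex.exp (z.arg * Complex.I), Complex.norm_exp_ofReal_mul_I _, by
        rw [mul_comm]; exact (Complex.norm_mul_exp_arg_mul_I z).symm⟩
    conv_rhs => rw [hu.2]
    simp only [radial]
    rw [← (hsum _).tsum_eq, ← (hsum _).tsum_eq]
    refine tsum_congr fun k => (diamondTerm_mul_of_norm_eq_one (fun k => ?_) (fun k => ?_) hu.1
      (radial_mul_of_norm_eq_one φ hu.1) (radial_mul_of_norm_eq_one ψ hu.1) k _).symm
    · rw [hφm, dz_iterate_fourierDensity hR hh]
      exact (contDiff_fourierDensity hR (isBoundedDensity_pow_mul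
        (isBoundedDensity_I_mul_conj hR) hh k)).differentiable (by simp)
    · rw [hψn, dzbar_iterate_fourierDensity hS hg]
      exact (contDiff_fourierDensity hS (isBoundedDensity_pow_mul
        (isBoundedDensity_I_mul hS) hg k)).differentiable (by simp)
  have hdomφ := toeplitzDom_eq_fock hφd.continuous.aestronglyMeasurable hM
  have hdomψ := toeplitzDom_eq_fock hψd.continuous.aestronglyMeasurable hN
  have hdom : compDom (radial φ) (radial ψ) = fock := by
    ext f
    rw [compDom, mem_ofPred_eq, hdomφ, hdomψ]
    exact ⟨fun hf => hf.1, fun hf =>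
      ⟨hf, toeplitz_mem_fock hψd.continuous.aestronglyMeasurable hN hf⟩⟩
  have hDT : IsToeplitz D := fun a =>
    mem_toeplitzDom_of_bounded hc.aestronglyMeasurable hB (coherent_mem_fock a)
  refine ⟨⟨hφd, hψd, fun z => (hsum z).summable⟩,
    compositionHypotheses_of_bounded hφd.continuous hψd.continuous hM hN,
    ⟨fun r => D (r : ℂ), memL1Infty_of_bounded (M := B) (by rwa [hrad]) (by rwa [hrad]),
      by rwa [hrad], ?_, ?_⟩,
    fun τ hτ => ?_⟩
  · rw [hrad, hdom, toeplitzDom_eq_fock hc.aestronglyMeasurable hB]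
  · rw [hrad, hdom]
    exact hcomp
  · simp only [hdiamond]
    -- No boundedness of `τ` is available, but comparison on coherent states suffices, and these lie
    -- in the domain of the composition.
    refine ae_eq_of_toeplitz_coherent_eq hτ.toeplitz hDT fun a => ?_
    rw [hτ.eq_comp _ (hdom ▸ coherent_mem_fock a), hcomp _ (coherent_mem_fock a)]
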